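/- **Conventions.** For a simplicial group $\mathbf T$ let $NT_0=T_0$ and $NT_n=\bigcap_{i<n}\ker(d_i:T_n\to T_{n-1})$ $(n\ge 1)$ be its Moore complex, with differential induced by $d_n$, and let $D_n\le T_n$ be the subgroup generated by the degenerate elements. A *CW-basis* of $\mathbf T$ is a family of subsets $\mathfrak F_n\subseteq T_n$ such that $\mathfrak F_n$ freely generates $T_n$, $s_i(\mathfrak F_n)\subseteq\mathfrak F_{n+1}$ for $0\le i\le n$, and $d_i(x)=1$ for $0\le i<n$ whenever $x\in Y_n:=\mathfrak F_n\setminus\bigcup_i s_i(\mathfrak F_{n-1})$ $(n\geq 1)$. Put $X_0=\mathfrak F_0$, so $T_0=F(X_0)$. An augmented simplicial group $\mathbf T\to G$ is a *resolution* of $G$ if $T_0\to G$ is surjective with kernel $d_1(NT_1)$, and $\pi_n(\mathbf T)=1$ for all $n\ge1$. The *$2$-skeleton* of $\mathbf F$ is the simplicial subgroup generated by $F_0,F_1,F_2$, with the restricted CW-basis. Write $[a,b]=aba^{-1}b^{-1}$, and $\langle S\rangle$ for the normal closure of $S$ in the ambient group. A *crossed complex* is a complex of groups $\cdots\to C_2\xrightarrow{\partial_2}C_1\xrightarrow{\partial_1}C_0$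 with $\partial_n\partial_{n+1}=1$, in which $C_0$ acts on every $C_n$, $n\ge1$, the $\partial_n$ are equivariant ($C_0$ acting on itself by conjugation), $\partial_1$ is a crossed module, $C_n$ is abelian and $\partial_1C_1$ acts trivially on $C_n$ for $n\ge2$. It is a *free crossed resolution* of $G$, with augmentation $C_0\to G$, if $\cdots\to C_2\to C_1\to C_0\to G\to1$ is exact, $C_0$ is a free group, $C_1\to C_0$ is a free crossed module and each $C_n$, $n\ge2$, is a free $\mathbb Z[G]$-module. **Proposition.** Let $\mathbf F^{(2)}$ be the $2$-skeleton of a free simplicial group with CW-basis that is a resolution of $G=F(X_0)/N$, the augmentation being the quotient map $g:F(X_0)\to F(X_0)/N$. Put $Z=\{s_1(y)^{-1}s_0(y):y\in Y_1\}\subseteq F^{(2)}_2$ and $Q_2=NF^{(2)}_2\cap D_2$. Let $P_1$ be the normal subgroup of $F^{(2)}_1$ generated by the Peiffer elements $xyx^{-1}\bigl(s_0d_1(x)\,y\,s_0d_1(x)^{-1}\bigr)^{-1}$, $x,y\in NF_1^{(2)}$, and let $P_2$ be the normal subgroup of $F^{(2)}_2$ generated by the elements 1. $[\,s_0x^{-1}\,s_1s_0d_1x,\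 y\,]$, 2. $[\,s_1x^{-1}\,s_0x,\ s_1d_2(y)\,y^{-1}\,]$, 3. $[\,y\,s_1d_2(y)^{-1}\,s_0d_2(y),\ s_1x\,]$, 4. $[\,y^{-1}\,s_1d_2(y),\ y'\,]$, 5. $[\,y\,s_1d_2(y)^{-1}\,s_0d_2(y),\ y'\,]$, 6. $[\,y\,s_1d_2(y)^{-1}\,s_0d_2(y),\ s_1d_2(y')\,y'^{-1}\,]$, for $x\in NF^{(2)}_1$ and $y,y'\in NF^{(2)}_2$. Then $$NF^{(2)}_1=\langle Y_1\rangle,\qquad NF^{(2)}_2=\langle s_1(Y_1)\cup Y_2\rangle\cap\langle Z\cup Y_2\rangle,$$ and the sequence $$NF^{(2)}_2/(Q_2\cdot P_2)\xrightarrow{\partial_2}\langle Y_1\rangle/P_1\xrightarrow{\partial_1}F(X_0)\xrightarrow{g}F(X_0)/N\to1,$$ with $\partial_2(y\,(Q_2\cdot P_2))=d_2(y)P_1$ and $\partial_1(xP_1)=d_1(x)$ (these maps being well defined), where $F(X_0)$ acts by conjugation through $s_1s_0$ and $s_0$ respectively, is the $2$-skeleton (the part in dimensions $\le 2$, together with its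 augmentation) of a free crossed resolution of $G$. In it $\partial_1$ is the free crossed module on $d_1:Y_1\to F(X_0)$, and $NF^{(2)}_2/(Q_2\cdot P_2)$ is the free $\mathbb Z[G]$-module on the classes of the elements of $Y_2$. -/

import Mathlib

open CategoryTheory Simplicial

universe u

namespace CrossedRes

/-! ### Crossed modules and crossed complexes -/

/-- A homomorphism `μ : M →* P` from a `P`-group `M` is a crossed module. -/
def IsCrossedModule {P M : Type u} [Group P] [Group M] [MulDistribMulAction P M]
    (μ : M →* P) : Prop :=
  (∀ (p : P) (m : M), μ (p • m) = p * μ m * p⁻¹) ∧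
    ∀ m m' : M, μ m • m' = m * m' * m⁻¹

/-- `μ : M →* P` is the free crossed `P`-module on the function `μ ∘ v : S → P`,
with universal function `v : S → M`. -/
def IsFreeCrossedModuleOn {P M S : Type u} [Group P] [Group M] [MulDistribMulAction P M]
    (μ : M →* P) (v : S → M) : Prop :=
  IsCrossedModule μ ∧
    ∀ (M' : Type u) [Group M'] [MulDistribMulAction P M'] (μ' : M' →* P),
      IsCrossedModule μ' → ∀ w : S → M', (∀ s, μ' (w s) = μ (v s)) →
        ∃! φ : M →* M', (∀ m, μ' (φ m) = μ m) ∧ (∀ (p : P) (m : M), φ (p • m) = p • φ m) ∧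
          ∀ s, φ (v s) = w s

/-- The `P`-group `M` is abelian, its action factors through `g : P →* G`, and the resulting
`ℤ[G]`-module (written additively) is free with basis `b`. -/
def IsFreeModuleOn {P G M S : Type u} [Group P] [Group G] [Group M] [MulDistribMulAction P M]
    (g : P →* G) (b : S → M) : Prop :=
  ∃ comm : ∀ x y : M, x * y = y * x,
    letI : CommGroup M := { (inferInstance : Group M) with mul_comm := comm }
    ∃ (_ : Module (MonoidAlgebra ℤ G) (Additive M))
      (β : Module.Basis S (MonoidAlgebra ℤ G) (Additive M)),
      (∀ (p : P) (m : M),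
        MonoidAlgebra.of ℤ G (g p) • Additive.ofMul m = Additive.ofMul (p • m)) ∧
      ∀ s, β s = Additive.ofMul (b s)

/-- A (reduced) crossed complex `⋯ → C₂ → C₁ → C₀`, indexed so that `C₁ → C₀` is a
crossed module. -/
structure CrossedComplex where
  C : ℕ → Type u
  [grp : ∀ n, Group (C n)]
  [act : ∀ n, MulDistribMulAction (C 0) (C (n + 1))]
  d : ∀ n, C (n + 1) →* C n
  d_zero_smul : ∀ (a : C 0) (x : C 1), d 0 (a • x) = a * d 0 x * a⁻¹
  d_smul : ∀ (n : ℕ) (a : C 0) (x : C (n + 2)), d (n + 1) (a • x) = a • d (n + 1) x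
  d_d : ∀ (n : ℕ) (x : C (n + 2)), d n (d (n + 1) x) = 1
  peiffer : ∀ x y : C 1, d 0 x • y = x * y * x⁻¹
  comm : ∀ (n : ℕ) (x y : C (n + 2)), x * y = y * x
  d_smul_trivial : ∀ (n : ℕ) (x : C 1) (y : C (n + 2)), d 0 x • y = y

attribute [instance] CrossedComplex.grp CrossedComplex.act

/-- The crossed complex `K` with the augmentation `g : K₀ →* G` is a free crossed resolution
of the group `G`. -/
structure IsFreeCrossedResolution (K : CrossedComplex.{u}) {G : Type u} [Group G]
    (g : K.C 0 →* G) : Prop where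
  surjective : Function.Surjective g
  exact_zero : g.ker = (K.d 0).range
  exact_succ : ∀ n, (K.d n).ker = (K.d (n + 1)).range
  free_zero : IsFreeGroup (K.C 0)
  free_one : ∃ (S : Type u) (v : S → K.C 1), IsFreeCrossedModuleOn (K.d 0) v
  free_add_two : ∀ n, ∃ (S : Type u) (b : S → K.C (n + 2)), IsFreeModuleOn g b

/-! ### Simplicial groups -/

variable (T : SimplicialObject GrpCat.{u})

/-- The face operator `d_i`. -/
abbrev face {n : ℕ} (i : Fin (n + 2)) : T _⦋n + 1⦌ →* T _⦋n⦌ := (T.δ i).hom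

/-- The degeneracy operator `s_i`. -/
abbrev degen {n : ℕ} (i : Fin (n + 1)) : T _⦋n⦌ →* T _⦋n + 1⦌ := (T.σ i).hom

/-- The Moore complex: `NT_n` is the intersection of the kernels of `d_0, …, d_{n-1}`. -/
def moore (n : ℕ) : Subgroup (T _⦋n⦌) :=
  match n with
  | 0 => ⊤
  | n + 1 => ⨅ i : Fin (n + 1), (face T i.castSucc).ker

/-- The subgroup of `T_n` generated by the degenerate elements. -/
def degenerate (n : ℕ) : Subgroup (T _⦋n⦌) :=
  match n with
  | 0 => ⊥
  | n + 1 => ⨆ i : Fin (n + 1), (degen T i).range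

variable {T} in
theorem mem_moore_succ {n : ℕ} {x : T _⦋n + 1⦌} :
    x ∈ moore T (n + 1) ↔ ∀ i : Fin (n + 1), face T i.castSucc x = 1 := by
  simp [moore, Subgroup.mem_iInf, MonoidHom.mem_ker]

theorem face_last_mem_moore (n : ℕ) (x : T _⦋n + 1⦌) (hx : x ∈ moore T (n + 1)) :
    face T (Fin.last (n + 1)) x ∈ moore T n := by
  cases n with
  | zero => exact Subgroup.mem_top _
  | succ n =>
    rw [mem_moore_succ] at hx ⊢
    intro i
    have h := T.δ_comp_δ (i := i.castSucc) (j := Fin.last (n + 1)) (Fin.le_last _)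
    have h' := congrArg (fun f => f.hom x) h
    simp only [GrpCat.hom_comp, MonoidHom.comp_apply] at h'
    have h2 := hx i.castSucc
    simp only [face] at h2 ⊢
    rw [← Fin.succ_last, h', h2, map_one]

/-- The differential `NT_{n+1} → NT_n`, the restriction of the last face operator. -/
def mooreD (n : ℕ) : moore T (n + 1) →* moore T n :=
  ((face T (Fin.last (n + 1))).comp (moore T (n + 1)).subtype).codRestrict (moore T n)
    fun x => face_last_mem_moore T n x x.2

/-- `T` with the augmentation `g : T_0 →* G` is a resolution of `G`: it identifies `π_0(T)`
with `G`, and `π_n(T)` is trivial for `n ≥ 1`. -/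
structure IsResolution {G : Type u} [Group G] (g : T _⦋0⦌ →* G) : Prop where
  surjective : Function.Surjective g
  ker_eq : g.ker = (moore T 1).map (face T 1)
  acyclic : ∀ n : ℕ, moore T (n + 1) ⊓ (face T (Fin.last (n + 1))).ker =
    (moore T (n + 2)).map (face T (Fin.last (n + 2)))

variable {T}

/-- The non-degenerate elements `Y_n` of a family `B`, stable under degeneracies, of subsets
`B_n ⊆ T_n`. -/
def nondeg (B : ∀ n : ℕ, Set (T _⦋n⦌)) (n : ℕ) : Set (T _⦋n⦌) :=
  match n with
  | 0 => B 0
  | n + 1 => B (n + 1) \ ⋃ i : Fin (n + 1), degen T i '' B n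

/-- `B` is a CW-basis of the simplicial group `T`. -/
structure IsCWBasis (B : ∀ n : ℕ, Set (T _⦋n⦌)) : Prop where
  free : ∀ n, Function.Bijective (FreeGroup.lift (fun b : B n => (b : T _⦋n⦌)))
  degen_mem : ∀ (n : ℕ) (i : Fin (n + 1)), ∀ x ∈ B n, degen T i x ∈ B (n + 1)
  face_nondeg : ∀ n : ℕ, ∀ x ∈ nondeg B (n + 1), ∀ i : Fin (n + 1),
    face T i.castSucc x = 1

variable (T) in
/-- Degree `n` of the `k`-skeleton of `T`: the simplicial subgroup generated by the elements
of dimension at most `k`. -/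
def skeletonSubgroup (k n : ℕ) : Subgroup (T _⦋n⦌) :=
  ⨆ (m : ℕ) (_ : m ≤ k) (t : ⦋n⦌ ⟶ ⦋m⦌), (T.map t.op).hom.range

/-- `T`, with the basis `B` and the augmentation `g : T_0 →* G`, is (a copy `ι` of) the
`k`-skeleton of a free simplicial group `F` with CW-basis `BF` that is a resolution of `G`. -/
def IsSkeletonOfFreeResolution (k : ℕ) (B : ∀ n : ℕ, Set (T _⦋n⦌))
    {G : Type u} [Group G] (g : T _⦋0⦌ →* G) : Prop :=
  ∃ (F : SimplicialObject GrpCat.{u}) (BF : ∀ n : ℕ, Set (F _⦋n⦌)) (gF : F _⦋0⦌ →* G)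
    (ι : T ⟶ F),
    IsCWBasis BF ∧ IsResolution F gF ∧
    (∀ n : ℕ, Function.Injective (ι.app (.op ⦋n⦌)).hom) ∧
    (∀ n : ℕ, (ι.app (.op ⦋n⦌)).hom.range = skeletonSubgroup F k n) ∧
    (∀ n : ℕ, B n = (ι.app (.op ⦋n⦌)).hom ⁻¹' BF n) ∧
    gF.comp (ι.app (.op ⦋0⦌)).hom = g

/-! ### Peiffer subgroups -/

variable (T)

/-- The commutator `[a, b] = a b a⁻¹ b⁻¹`. -/
def comm {G : Type u} [Group G] (a b : G) : G := a * b * a⁻¹ * b⁻¹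

/-- `d_1 : T_1 → T_0` -/
abbrev d₁ : T _⦋1⦌ →* T _⦋0⦌ := face T (n := 0) 1

/-- `d_2 : T_2 → T_1` -/
abbrev d₂ : T _⦋2⦌ →* T _⦋1⦌ := face T (n := 1) 2

/-- `s_0 : T_0 → T_1` -/
abbrev s₀' : T _⦋0⦌ →* T _⦋1⦌ := degen T (n := 0) 0

/-- `s_0 : T_1 → T_2` -/
abbrev s₀ : T _⦋1⦌ →* T _⦋2⦌ := degen T (n := 1) 0

/-- `s_1 : T_1 → T_2` -/
abbrev s₁ : T _⦋1⦌ →* T _⦋2⦌ := degen T (n := 1) 1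

/-- The first dimensional Peiffer subgroup: the normal subgroup of `T_1` generated by the
Peiffer elements `x y x⁻¹ (ˣy)⁻¹`, where `ˣy` is the action of `d_1 x` through `s_0`. -/
def P₁ : Subgroup (T _⦋1⦌) :=
  Subgroup.normalClosure {w | ∃ x ∈ moore T 1, ∃ y ∈ moore T 1,
    w = x * y * x⁻¹ *
      (s₀' T (d₁ T x) * y * (s₀' T (d₁ T x))⁻¹)⁻¹}

/-- The second dimensional Peiffer subgroup: the normal subgroup of `T_2` generated by the
following six families of elements. -/
def P₂ : Subgroup (T _⦋2⦌) :=
  Subgroup.normalClosure (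
    {w | ∃ x ∈ moore T 1, ∃ y ∈ moore T 2,
      w = comm ((s₀ T x)⁻¹ * s₁ T (s₀' T (d₁ T x))) y} ∪
    {w | ∃ x ∈ moore T 1, ∃ y ∈ moore T 2,
      w = comm ((s₁ T x)⁻¹ * s₀ T x) (s₁ T (d₂ T y) * y⁻¹)} ∪
    {w | ∃ x ∈ moore T 1, ∃ y ∈ moore T 2,
      w = comm (y * (s₁ T (d₂ T y))⁻¹ * s₀ T (d₂ T y)) (s₁ T x)} ∪
    {w | ∃ y ∈ moore T 2, ∃ y' ∈ moore T 2,
      w = comm (y⁻¹ * s₁ T (d₂ T y)) y'} ∪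
    {w | ∃ y ∈ moore T 2, ∃ y' ∈ moore T 2,
      w = comm (y * (s₁ T (d₂ T y))⁻¹ * s₀ T (d₂ T y)) y'} ∪
    {w | ∃ y ∈ moore T 2, ∃ y' ∈ moore T 2,
      w = comm (y * (s₁ T (d₂ T y))⁻¹ * s₀ T (d₂ T y)) (s₁ T (d₂ T y') * y'⁻¹)})

instance : (P₁ T).Normal := Subgroup.normalClosure_normal

instance : (P₂ T).Normal := Subgroup.normalClosure_normal

/-- `Q_2 = NT_2 ∩ D_2`. -/
def Q₂ : Subgroup (T _⦋2⦌) := moore T 2 ⊓ degenerate T 2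

instance moore_normal (n : ℕ) : (moore T n).Normal := by
  cases n with
  | zero => exact Subgroup.normal_of_characteristic ⊤
  | succ n => exact Subgroup.normal_iInf_normal fun i => MonoidHom.normal_ker _

/-- `Q_2 · P_2` is a normal subgroup of `NT_2` (as `P_2` is normal in `T_2`, the product is the
join). -/
instance Q₂P₂_normal : ((Q₂ T ⊔ P₂ T).subgroupOf (moore T 2)).Normal := by
  have key : ∀ y ∈ moore T 2, ∀ q ∈ Q₂ T, y * q * y⁻¹ ∈ Q₂ T ⊔ P₂ T := by
    intro y hy q hq
    have h1 : comm (y⁻¹ * s₁ T (d₂ T y)) q ∈ P₂ T :=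
      Subgroup.subset_normalClosure (Or.inl (Or.inl (Or.inr ⟨y, hy, q, hq.1, rfl⟩)))
    have h2 : s₁ T (d₂ T y) ∈ degenerate T 2 :=
      Subgroup.mem_iSup_of_mem (1 : Fin 2) ⟨_, rfl⟩
    generalize s₁ T (d₂ T y) = s at h1 h2
    have h3 : s * q * s⁻¹ ∈ Q₂ T :=
      ⟨(moore_normal T 2).conj_mem q hq.1 s, mul_mem (mul_mem h2 hq.2) ((degenerate T 2).inv_mem h2)⟩
    have h4 : y * q * y⁻¹ = y * (comm (y⁻¹ * s) q)⁻¹ * y⁻¹ * (s * q * s⁻¹) := by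
      unfold comm; group
    rw [h4]
    exact mul_mem (Subgroup.mem_sup_right
      (Subgroup.Normal.conj_mem inferInstance _ ((P₂ T).inv_mem h1) y)) (Subgroup.mem_sup_left h3)
  refine ⟨fun a ha y => ?_⟩
  rw [Subgroup.mem_subgroupOf] at ha ⊢
  rw [← SetLike.mem_coe, Subgroup.mul_normal] at ha
  obtain ⟨q, hq, p, hp, hqp⟩ := Set.mem_mul.mp ha
  have h : ((y * a * y⁻¹ : moore T 2) : T _⦋2⦌) =
      ((y : T _⦋2⦌) * q * (y : T _⦋2⦌)⁻¹) * ((y : T _⦋2⦌) * p * (y : T _⦋2⦌)⁻¹) := by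
    push_cast
    rw [← hqp]; group
  rw [h]
  exact mul_mem (key y y.2 q hq) (Subgroup.mem_sup_right
    (Subgroup.Normal.conj_mem inferInstance _ hp _))

/-- The group `NT_1 / P_1`. -/
abbrev C₁ : Type u := moore T 1 ⧸ (P₁ T).subgroupOf (moore T 1)

/-- The group `NT_2 / (Q_2 · P_2)`. -/
abbrev C₂ : Type u := moore T 2 ⧸ (Q₂ T ⊔ P₂ T).subgroupOf (moore T 2)

end CrossedRes

open CrossedRes

/-! In dimensions at most 2 the skeleton agrees with the ambient resolution, so only three things
matter: the free bases of `T_0`, `T_1`, `T_2`, the equality `ker g = d_1(NT_1)`, and `π_1 = 1`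
(`isLowDimResolution_of_skeleton`).

Modulo `P_1`, elements of `ker d_0` and `ker d_1` commute. Hence the middle face of a degenerate
2-simplex is determined by its outer faces (`d₁₂_eq_mod_P₁`), and `d_2` sends `Q_2` into `P_1`. A
crossed module `M` over `T_0` receives a map from `NT_1 / P_1` because `T_1` is free and can be
mapped to `M ⋊ T_0`.

For `NT_2 / (Q_2 · P_2)`, families 1 to 4 of `P_2`, together with commutators lying in `Q_2`, force
`T_2` to act by conjugation through the vertex `d_0 d_0 t` modulo `d_1(NT_1)`, that is, through `G`
(`mem_actionKernel_of_vertex`). As `NT_2 = ⟨Y_2⟩ · Q_2`, the quotient is abelian and generated by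
the `G`-translates of `Y_2`. A Fox derivative from `T_2` to the semidirect product of `ℤ[G]^{Y_2}`
with `G` shows that these have no relations (`exists_fox`, `exists_equiv`).

Exactness at `NT_1 / P_1` is `π_1 = 1`. Above dimension 2 the complex is continued by a free
`ℤ[G]`-resolution of `ker ∂_2`, independent of `T`. -/

namespace CrossedRes

/-! ### Free `ℤ[G]`-modules and their standard resolutions -/

/-- The action of `P` on a `ℤ[G]`-module, in multiplicative notation, through `g : P →* G`. -/
@[reducible]
noncomputable def pullbackAction {P G : Type u} [Group P] [Group G] (g : P →* G) (A : Type u) [AddCommGroup A]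
    [Module (MonoidAlgebra ℤ G) A] : MulDistribMulAction P (Multiplicative A) where
  smul p x := Multiplicative.ofAdd (MonoidAlgebra.of ℤ G (g p) • x.toAdd)
  one_smul x := by
    change Multiplicative.ofAdd (MonoidAlgebra.of ℤ G (g 1) • x.toAdd) = x
    rw [map_one, map_one, one_smul, ofAdd_toAdd]
  mul_smul p q x := by
    change Multiplicative.ofAdd (MonoidAlgebra.of ℤ G (g (p * q)) • x.toAdd) =
      Multiplicative.ofAdd (MonoidAlgebra.of ℤ G (g p) • MonoidAlgebra.of ℤ G (g q) • x.toAdd)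
    rw [map_mul, map_mul, mul_smul]
  smul_mul p x y := congrArg Multiplicative.ofAdd
    (smul_add (MonoidAlgebra.of ℤ G (g p)) x.toAdd y.toAdd)
  smul_one p := congrArg Multiplicative.ofAdd (smul_zero (MonoidAlgebra.of ℤ G (g p)))

/-- Freeness of a `P`-group over `ℤ[G]` can be transported along an equivariant isomorphism
from a free `ℤ[G]`-module. -/
theorem isFreeModuleOn_of_equiv {P G M A S : Type u} [Group P] [Group G] [Group M]
    [MulDistribMulAction P M] (g : P →* G) [AddCommGroup A] [Module (MonoidAlgebra ℤ G) A]
    (β : Module.Basis S (MonoidAlgebra ℤ G) A) (e : Multiplicative A ≃* M)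
    (he : ∀ (p : P) (x : A), e (.ofAdd (MonoidAlgebra.of ℤ G (g p) • x)) = p • e (.ofAdd x)) :
    IsFreeModuleOn g (fun s => e (.ofAdd (β s))) := by
  have comm : ∀ x y : M, x * y = y * x := fun x y => by
    obtain ⟨x, rfl⟩ := e.surjective x
    obtain ⟨y, rfl⟩ := e.surjective y
    rw [← map_mul, mul_comm, map_mul]
  refine ⟨comm, ?_⟩
  let _ : CommGroup M := { (inferInstance : Group M) with mul_comm := comm }
  let e' : Additive M ≃+ A := AddEquiv.symm (MulEquiv.toAdditiveRight e)
  let _ := e'.module (MonoidAlgebra ℤ G)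
  let l : Additive M ≃ₗ[MonoidAlgebra ℤ G] A :=
    { e' with map_smul' := fun r x => e'.apply_symm_apply _ }
  refine ⟨inferInstance, β.map l.symm, fun p m => ?_, fun s => ?_⟩
  · obtain ⟨x, rfl⟩ := e.surjective m
    refine Eq.trans ?_ (congrArg Additive.ofMul (he p x.toAdd))
    change e'.symm (MonoidAlgebra.of ℤ G (g p) • e' (e'.symm x.toAdd)) = e'.symm _
    rw [e'.apply_symm_apply]
    rfl
  · rw [Module.Basis.map_apply]
    rfl

/-- A free module together with a submodule, to be covered by the next stage of a resolution. -/
structure FreeStage (R : Type u) [Ring R] where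
  S : Type u
  K : Submodule R (S →₀ R)

/-- The stages of the standard free resolution continuing a given stage. -/
@[reducible]
noncomputable def FreeStage.iterate {R : Type u} [Ring R] (X : FreeStage R) (n : ℕ) :
    FreeStage R :=
  match n with
  | 0 => X
  | n + 1 => ⟨(X.iterate n).K,
      LinearMap.ker (Finsupp.linearCombination R fun x : (X.iterate n).K => x.1)⟩

/-- The differentials of the standard free resolution continuing a given stage. -/
noncomputable def FreeStage.diff {R : Type u} [Ring R] (X : FreeStage R) (n : ℕ) :
    ((X.iterate (n + 1)).S →₀ R) →ₗ[R] ((X.iterate n).S →₀ R) :=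
  Finsupp.linearCombination R fun x : (X.iterate n).K => x.1

theorem FreeStage.range_diff {R : Type u} [Ring R] (X : FreeStage R) (n : ℕ) :
    LinearMap.range (X.diff n) = (X.iterate n).K := by
  rw [FreeStage.diff, Finsupp.range_linearCombination]
  simp

/-! ### Continuing a crossed module by a free resolution -/

section Extension

variable {P G M : Type u} [Group P] [Group G] [Group M] [MulDistribMulAction P M]

/-- The groups of the crossed complex which continues `M → P` by a free resolution. -/
@[reducible]
def extensionObj (P M : Type u) {G : Type u} [Group G] (X : FreeStage (MonoidAlgebra ℤ G)) (n : ℕ) :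
    Type u :=
  match n with
  | 0 => P
  | 1 => M
  | n + 2 => Multiplicative ((X.iterate n).S →₀ MonoidAlgebra ℤ G)

/-- The group structures on the terms of the extended complex. -/
@[reducible]
noncomputable def extensionGroup (P M : Type u) [Group P] [Group M]
    (X : FreeStage (MonoidAlgebra ℤ G)) (n : ℕ) :
    Group (extensionObj P M X n) :=
  match n with
  | 0 => inferInstanceAs (Group P)
  | 1 => inferInstanceAs (Group M)
  | n + 2 => inferInstanceAs (Group (Multiplicative ((X.iterate n).S →₀ MonoidAlgebra ℤ G)))

attribute [local instance] extensionGroup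

/-- The actions of `P` on the terms of the extended complex. -/
@[reducible]
noncomputable def extensionAction (g : P →* G) (X : FreeStage (MonoidAlgebra ℤ G)) (n : ℕ) :
    MulDistribMulAction P (extensionObj P M X (n + 1)) :=
  match n with
  | 0 => inferInstanceAs (MulDistribMulAction P M)
  | n + 1 => pullbackAction g ((X.iterate n).S →₀ MonoidAlgebra ℤ G)

/-- The boundary maps of the extended complex. -/
@[reducible]
noncomputable def extensionD (X : FreeStage (MonoidAlgebra ℤ G)) (μ : M →* P)
    (del : Multiplicative (X.S →₀ MonoidAlgebra ℤ G) →* M) (n : ℕ) :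
    extensionObj P M X (n + 1) →* extensionObj P M X n :=
  match n with
  | 0 => μ
  | 1 => del
  | n + 2 => AddMonoidHom.toMultiplicative (X.diff n).toAddMonoidHom

/-- The crossed complex obtained from a crossed module `μ : M → P` and an equivariant map
`∂ : F → M` from a free `ℤ[G]`-module by continuing with a free resolution of `ker ∂`. -/
noncomputable def extension (g : P →* G) (X : FreeStage (MonoidAlgebra ℤ G)) (μ : M →* P)
    (hμ : IsCrossedModule μ) (hg : ∀ x, g (μ x) = 1)
    (del : Multiplicative (X.S →₀ MonoidAlgebra ℤ G) →* M)
    (hK : ∀ x, del (.ofAdd x) = 1 ↔ x ∈ X.K)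
    (hdel : ∀ (p : P) x, del (.ofAdd (MonoidAlgebra.of ℤ G (g p) • x)) = p • del (.ofAdd x))
    (hμdel : ∀ x, μ (del x) = 1) : CrossedComplex.{u} where
  C := extensionObj P M X
  grp := extensionGroup P M X
  act := extensionAction g X
  d := extensionD X μ del
  d_zero_smul := hμ.1
  d_smul n := match n with
    | 0 => fun p x => hdel p x.toAdd
    | n + 1 => fun p x => congrArg Multiplicative.ofAdd
        ((X.diff n).map_smul (MonoidAlgebra.of ℤ G (g p)) x.toAdd)
  d_d n := match n with
    | 0 => hμdel
    | 1 => fun x => (hK _).2 ((X.range_diff 0).le ⟨x.toAdd, rfl⟩)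
    | n + 2 => fun x => congrArg Multiplicative.ofAdd
        ((X.range_diff (n + 1)).le ⟨x.toAdd, rfl⟩ : X.diff n _ = 0)
  peiffer := hμ.2
  comm n x y := mul_comm (G := Multiplicative ((X.iterate n).S →₀ MonoidAlgebra ℤ G)) x y
  d_smul_trivial n x y := by
    have h : MonoidAlgebra.of ℤ G (g (μ x)) • (Multiplicative.toAdd
        (α := (X.iterate n).S →₀ MonoidAlgebra ℤ G) y) = Multiplicative.toAdd
        (α := (X.iterate n).S →₀ MonoidAlgebra ℤ G) y := by
      rw [hg, map_one, one_smul]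
    exact congrArg Multiplicative.ofAdd h

/-- From degree 2 on, exactness is built in: each differential has as its image the kernel of the
preceding map, the first of these kernels being `X.K = ker del`. Below that it is assumed. -/
theorem extension_isFreeCrossedResolution [IsFreeGroup P] (g : P →* G)
    (X : FreeStage (MonoidAlgebra ℤ G)) (μ : M →* P)
    (hμ : IsCrossedModule μ) (hg : ∀ x, g (μ x) = 1)
    (del : Multiplicative (X.S →₀ MonoidAlgebra ℤ G) →* M)
    (hK : ∀ x, del (.ofAdd x) = 1 ↔ x ∈ X.K)
    (hdel : ∀ (p : P) x, del (.ofAdd (MonoidAlgebra.of ℤ G (g p) • x)) = p • del (.ofAdd x))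
    (hμdel : ∀ x, μ (del x) = 1) (hsurj : Function.Surjective g)
    (hker : g.ker = μ.range) (hker' : μ.ker = del.range)
    {Y : Type u} (v : Y → M) (hv : IsFreeCrossedModuleOn μ v) :
    IsFreeCrossedResolution (extension g X μ hμ hg del hK hdel hμdel)
      (show (extension g X μ hμ hg del hK hdel hμdel).C 0 →* G from g) where
  surjective := hsurj
  exact_zero := hker
  exact_succ n := match n with
    | 0 => hker'
    | 1 => Subgroup.ext fun x => (hK (Multiplicative.toAdd
        (α := (X.iterate 0).S →₀ MonoidAlgebra ℤ G) x)).trans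
          (SetLike.ext_iff.1 (X.range_diff 0) (Multiplicative.toAdd
        (α := (X.iterate 0).S →₀ MonoidAlgebra ℤ G) x)).symm
    | n + 2 => Subgroup.ext fun x =>
        (SetLike.ext_iff.1 (X.range_diff (n + 1)) (Multiplicative.toAdd
        (α := (X.iterate (n + 1)).S →₀ MonoidAlgebra ℤ G) x)).symm
  free_zero := inferInstanceAs (IsFreeGroup P)
  free_one := ⟨Y, v, hv⟩
  free_add_two n := ⟨(X.iterate n).S, _,
    let _ := pullbackAction g ((X.iterate n).S →₀ MonoidAlgebra ℤ G)
    isFreeModuleOn_of_equiv g (Finsupp.basisSingleOne (ι := (X.iterate n).S))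
      (MulEquiv.refl _) fun _ _ => rfl⟩

end Extension

/-! ### Kernels as normal closures, maps out of free groups -/

section GroupTheory

/-- A criterion for the kernel of a homomorphism to be the normal closure of a given set. -/
theorem ker_eq_normalClosure {A Q : Type*} [Group A] [Group Q] (f : A →* Q) (s : Q →* A)
    {S D : Set A} (hS : ∀ x ∈ S, f x = 1) (hD : Subgroup.closure D = ⊤)
    (h : ∀ b ∈ D, b * (s (f b))⁻¹ ∈ Subgroup.normalClosure S) :
    f.ker = Subgroup.normalClosure S := by
  refine le_antisymm (fun x hx => ?_) (Subgroup.normalClosure_le_normal hS)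
  -- Modulo the normal closure, the identity and `s ∘ f` agree on generators, hence everywhere, and
  -- `s ∘ f` is trivial on `ker f`.
  have key : QuotientGroup.mk' (Subgroup.normalClosure S) =
      (QuotientGroup.mk' (Subgroup.normalClosure S)).comp (s.comp f) := by
    refine MonoidHom.eq_of_eqOn_dense hD fun b hb => ?_
    have := (QuotientGroup.eq_one_iff _).2 (h b hb)
    rw [QuotientGroup.mk_mul, QuotientGroup.mk_inv, mul_inv_eq_one] at this
    exact this
  have := DFunLike.congr_fun key x
  rw [MonoidHom.comp_apply, MonoidHom.comp_apply, MonoidHom.mem_ker.1 hx, map_one, map_one] at this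
  exact (QuotientGroup.eq_one_iff x).1 this

/-- The extension of a function on a free basis to a homomorphism. -/
theorem exists_hom_of_bijective_lift {A H : Type*} [Group A] [Group H] {D : Set A}
    (hD : Function.Bijective (FreeGroup.lift (fun b : D => (b : A)))) (f : D → H) :
    ∃ F : A →* H, ∀ b : D, F b = f b := by
  let e : FreeGroup D ≃* A := MulEquiv.ofBijective _ hD
  refine ⟨(FreeGroup.lift f).comp e.symm.toMonoidHom, fun b => ?_⟩
  have : e.symm b = FreeGroup.of b := by
    rw [MulEquiv.symm_apply_eq]
    exact (FreeGroup.lift_apply_of).symm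
  change FreeGroup.lift f (e.symm b) = f b
  rw [this, FreeGroup.lift_apply_of]

theorem closure_eq_top_of_bijective_lift {A : Type*} [Group A] {D : Set A}
    (hD : Function.Bijective (FreeGroup.lift (fun b : D => (b : A)))) :
    Subgroup.closure D = ⊤ := by
  have := FreeGroup.range_lift_eq_closure (f := fun b : D => (b : A))
  rw [Subtype.range_coe] at this
  rw [← this]
  exact MonoidHom.range_eq_top.2 hD.2

end GroupTheory

/-! ### Simplicial identities in dimensions at most 2 -/

section Identities

variable (T : SimplicialObject GrpCat.{u})

/-- `d_0 : T_1 → T_0` -/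
abbrev d₀' : T _⦋1⦌ →* T _⦋0⦌ := face T (n := 0) 0

/-- `d_0 : T_2 → T_1` -/
abbrev d₀₂ : T _⦋2⦌ →* T _⦋1⦌ := face T (n := 1) 0

/-- `d_1 : T_2 → T_1` -/
abbrev d₁₂ : T _⦋2⦌ →* T _⦋1⦌ := face T (n := 1) 1

theorem d₀'_s₀' (x : T _⦋0⦌) : d₀' T (s₀' T x) = x :=
  congrArg (fun f => f.hom x) (T.δ_comp_σ_self (n := 0) (i := 0))

theorem d₁_s₀' (x : T _⦋0⦌) : d₁ T (s₀' T x) = x :=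
  congrArg (fun f => f.hom x) (T.δ_comp_σ_succ (n := 0) (i := 0))

theorem d₀₂_s₀ (x : T _⦋1⦌) : d₀₂ T (s₀ T x) = x :=
  congrArg (fun f => f.hom x) (T.δ_comp_σ_self (n := 1) (i := 0))

theorem d₁₂_s₀ (x : T _⦋1⦌) : d₁₂ T (s₀ T x) = x :=
  congrArg (fun f => f.hom x) (T.δ_comp_σ_succ (n := 1) (i := 0))

theorem d₁₂_s₁ (x : T _⦋1⦌) : d₁₂ T (s₁ T x) = x :=
  congrArg (fun f => f.hom x) (T.δ_comp_σ_self (n := 1) (i := 1))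

theorem d₂_s₁ (x : T _⦋1⦌) : d₂ T (s₁ T x) = x :=
  congrArg (fun f => f.hom x) (T.δ_comp_σ_succ (n := 1) (i := 1))

theorem d₀₂_s₁ (x : T _⦋1⦌) : d₀₂ T (s₁ T x) = s₀' T (d₀' T x) :=
  congrArg (fun f => f.hom x) (T.δ_comp_σ_of_le (n := 0) (i := 0) (j := 0) le_rfl)

theorem d₂_s₀ (x : T _⦋1⦌) : d₂ T (s₀ T x) = s₀' T (d₁ T x) :=
  congrArg (fun f => f.hom x) (T.δ_comp_σ_of_gt (n := 0) (i := 1) (j := 0) (by decide))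

theorem s₁_s₀' (x : T _⦋0⦌) : s₁ T (s₀' T x) = s₀ T (s₀' T x) :=
  (congrArg (fun f => f.hom x) (T.σ_comp_σ (n := 0) (i := 0) (j := 0) le_rfl)).symm

theorem d₀'_d₁₂ (x : T _⦋2⦌) : d₀' T (d₁₂ T x) = d₀' T (d₀₂ T x) :=
  congrArg (fun f => f.hom x) (T.δ_comp_δ (n := 0) (i := 0) (j := 0) le_rfl)

theorem d₀'_d₂ (x : T _⦋2⦌) : d₀' T (d₂ T x) = d₁ T (d₀₂ T x) :=
  congrArg (fun f => f.hom x) (T.δ_comp_δ (n := 0) (i := 0) (j := 1) (by decide))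

theorem d₁_d₂ (x : T _⦋2⦌) : d₁ T (d₂ T x) = d₁ T (d₁₂ T x) :=
  congrArg (fun f => f.hom x) (T.δ_comp_δ (n := 0) (i := 1) (j := 1) le_rfl)

variable {T}

theorem mem_moore_one {x : T _⦋1⦌} : x ∈ moore T 1 ↔ d₀' T x = 1 := by
  rw [mem_moore_succ]
  exact ⟨fun h => h 0, fun h i => by rw [Fin.fin_one_eq_zero i]; exact h⟩

theorem mem_moore_two {x : T _⦋2⦌} : x ∈ moore T 2 ↔ d₀₂ T x = 1 ∧ d₁₂ T x = 1 := by
  rw [mem_moore_succ, Fin.forall_fin_two]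
  rfl

theorem degen_mem_degenerate (i : Fin 2) (x : T _⦋1⦌) : degen T i x ∈ degenerate T 2 :=
  Subgroup.mem_iSup_of_mem i ⟨_, rfl⟩

theorem s₀_mem_degenerate (x : T _⦋1⦌) : s₀ T x ∈ degenerate T 2 := degen_mem_degenerate 0 x

theorem s₁_mem_degenerate (x : T _⦋1⦌) : s₁ T x ∈ degenerate T 2 := degen_mem_degenerate 1 x

theorem degenerate_two_le {H : Subgroup (T _⦋2⦌)} (h₀ : ∀ x, s₀ T x ∈ H) (h₁ : ∀ x, s₁ T x ∈ H) :
    degenerate T 2 ≤ H := by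
  refine iSup_le fun i => ?_
  rintro _ ⟨x, rfl⟩
  fin_cases i
  exacts [h₀ x, h₁ x]

theorem d₂_mem_moore {y : T _⦋2⦌} (hy : y ∈ moore T 2) : d₂ T y ∈ moore T 1 :=
  face_last_mem_moore T 1 y hy

end Identities

/-! ### Peiffer subgroups and the boundary map -/

section Peiffer

variable (T : SimplicialObject GrpCat.{u})

theorem d₁_eq_one_of_mem_P₁ {w : T _⦋1⦌} (hw : w ∈ P₁ T) : d₁ T w = 1 := by
  have : P₁ T ≤ (d₁ T).ker := by
    refine Subgroup.normalClosure_le_normal ?_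
    rintro _ ⟨x, hx, y, hy, rfl⟩
    rw [SetLike.mem_coe, MonoidHom.mem_ker]
    simp only [map_mul, map_inv, d₁_s₀']
    group
  exact this hw

theorem peiffer_mem_P₁ {x y : T _⦋1⦌} (hx : x ∈ moore T 1) (hy : y ∈ moore T 1) :
    x * y * x⁻¹ * (s₀' T (d₁ T x) * y * (s₀' T (d₁ T x))⁻¹)⁻¹ ∈ P₁ T :=
  Subgroup.subset_normalClosure ⟨x, hx, y, hy, rfl⟩

/-- Elements of `ker d_1` and of `ker d_0` commute modulo `P_1`. -/
theorem mul_comm_mod_P₁ {u v : T _⦋1⦌} (hu : d₁ T u = 1) (hv : d₀' T v = 1) :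
    ((u * v : T _⦋1⦌) : T _⦋1⦌ ⧸ P₁ T) = (v * u : T _⦋1⦌) := by
  -- The Peiffer element of this `x` and the `y` below is `[u, v]`: as `d_1 u = 1`, the action of
  -- `d_1 x` is conjugation by `s_0(d_0 u)⁻¹`, which undoes the conjugation in `y`.
  have hx : u * (s₀' T (d₀' T u))⁻¹ ∈ moore T 1 := by
    rw [mem_moore_one, map_mul, map_inv, d₀'_s₀', mul_inv_cancel]
  have hy : s₀' T (d₀' T u) * v * (s₀' T (d₀' T u))⁻¹ ∈ moore T 1 :=
    (moore_normal T 1).conj_mem v (mem_moore_one.2 hv) _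
  have h := peiffer_mem_P₁ T hx hy
  rw [map_mul, hu, map_inv, d₁_s₀', one_mul, map_inv] at h
  rw [QuotientGroup.eq_iff_div_mem]
  rw [div_eq_mul_inv]
  convert h using 1
  group

/-- Modulo `P_1`, the middle face of a degenerate `2`-simplex is the composite of the outer
faces. -/
theorem d₁₂_eq_mod_P₁ {w : T _⦋2⦌} (hw : w ∈ degenerate T 2) :
    ((d₁₂ T w : T _⦋1⦌) : T _⦋1⦌ ⧸ P₁ T) =
      (d₀₂ T w * (s₀' T (d₁ T (d₀₂ T w)))⁻¹ * d₂ T w : T _⦋1⦌) := by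
  -- The right-hand side is multiplicative in `w`, because the two factors to be interchanged lie in
  -- `ker d_1` and `ker d_0`. It then suffices to compare both sides on `s_0 x` and `s_1 x`.
  let comp : T _⦋2⦌ →* T _⦋1⦌ ⧸ P₁ T := MonoidHom.mk'
    (fun w => ((d₀₂ T w * (s₀' T (d₁ T (d₀₂ T w)))⁻¹ * d₂ T w : T _⦋1⦌) : T _⦋1⦌ ⧸ P₁ T))
    fun w w' => by
      have hu : d₁ T (d₀₂ T w' * (s₀' T (d₁ T (d₀₂ T w')))⁻¹) = 1 := by
        rw [map_mul, map_inv, d₁_s₀', mul_inv_cancel]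
      have hv : d₀' T ((s₀' T (d₁ T (d₀₂ T w)))⁻¹ * d₂ T w) = 1 := by
        rw [map_mul, map_inv, d₀'_s₀', d₀'_d₂, inv_mul_cancel]
      have h := congrArg (fun z => (d₀₂ T w : T _⦋1⦌ ⧸ P₁ T) * z * (d₂ T w' : T _⦋1⦌ ⧸ P₁ T))
        (mul_comm_mod_P₁ T hu hv)
      simp only [map_mul, mul_inv_rev, QuotientGroup.mk_mul, mul_assoc] at h ⊢
      exact h
  let mid : T _⦋2⦌ →* T _⦋1⦌ ⧸ P₁ T := (QuotientGroup.mk' (P₁ T)).comp (d₁₂ T)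
  have h : degenerate T 2 ≤ mid.eqLocus comp := by
    refine degenerate_two_le (fun x => ?_) fun x => ?_
    · change ((d₁₂ T (s₀ T x) : T _⦋1⦌) : T _⦋1⦌ ⧸ P₁ T) = ((_ : T _⦋1⦌) : T _⦋1⦌ ⧸ P₁ T)
      rw [d₁₂_s₀, d₀₂_s₀, d₂_s₀, inv_mul_cancel_right]
    · change ((d₁₂ T (s₁ T x) : T _⦋1⦌) : T _⦋1⦌ ⧸ P₁ T) = ((_ : T _⦋1⦌) : T _⦋1⦌ ⧸ P₁ T)
      rw [d₁₂_s₁, d₀₂_s₁, d₂_s₁, d₁_s₀', mul_inv_cancel, one_mul]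
  exact h hw

theorem d₂_mem_P₁_of_mem_Q₂ {w : T _⦋2⦌} (hw : w ∈ Q₂ T) : d₂ T w ∈ P₁ T := by
  have h := d₁₂_eq_mod_P₁ T hw.2
  obtain ⟨h₀, h₁⟩ := mem_moore_two.1 hw.1
  rw [h₀, h₁, map_one, map_one, inv_one, one_mul, one_mul] at h
  exact (QuotientGroup.eq_one_iff _).1 h.symm

variable {T}

/-- A normal subgroup contains `P_2` if it contains the six families of generators. -/
theorem P₂_le {H : Subgroup (T _⦋2⦌)} [H.Normal]
    (h₁ : ∀ x ∈ moore T 1, ∀ y ∈ moore T 2,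
      comm ((s₀ T x)⁻¹ * s₁ T (s₀' T (d₁ T x))) y ∈ H)
    (h₂ : ∀ x ∈ moore T 1, ∀ y ∈ moore T 2,
      comm ((s₁ T x)⁻¹ * s₀ T x) (s₁ T (d₂ T y) * y⁻¹) ∈ H)
    (h₃ : ∀ x ∈ moore T 1, ∀ y ∈ moore T 2,
      comm (y * (s₁ T (d₂ T y))⁻¹ * s₀ T (d₂ T y)) (s₁ T x) ∈ H)
    (h₄ : ∀ y ∈ moore T 2, ∀ y' ∈ moore T 2, comm (y⁻¹ * s₁ T (d₂ T y)) y' ∈ H)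
    (h₅ : ∀ y ∈ moore T 2, ∀ y' ∈ moore T 2,
      comm (y * (s₁ T (d₂ T y))⁻¹ * s₀ T (d₂ T y)) y' ∈ H)
    (h₆ : ∀ y ∈ moore T 2, ∀ y' ∈ moore T 2,
      comm (y * (s₁ T (d₂ T y))⁻¹ * s₀ T (d₂ T y)) (s₁ T (d₂ T y') * y'⁻¹) ∈ H) :
    P₂ T ≤ H := by
  refine Subgroup.normalClosure_le_normal ?_
  rintro w (((((⟨x, hx, y, hy, rfl⟩ | ⟨x, hx, y, hy, rfl⟩) | ⟨x, hx, y, hy, rfl⟩) |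
    ⟨x, hx, y, hy, rfl⟩) | ⟨x, hx, y, hy, rfl⟩) | ⟨x, hx, y, hy, rfl⟩)
  exacts [h₁ x hx y hy, h₂ x hx y hy, h₃ x hx y hy, h₄ x hx y hy, h₅ x hx y hy, h₆ x hx y hy]

variable (T)

theorem P₂_le_moore : P₂ T ≤ moore T 2 := by
  apply P₂_le <;> intro x hx y hy
  all_goals
    have hy' := mem_moore_two.1 hy
    rw [mem_moore_two]
    simp only [comm, map_mul, map_inv, d₀₂_s₀, d₀₂_s₁, d₁₂_s₀, d₁₂_s₁, d₀'_d₂, hy'.1, hy'.2, map_one]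
  · constructor <;> group
  · rw [mem_moore_one.1 hx]
    constructor <;> simp
  · rw [mem_moore_one.1 hx]
    constructor <;> simp
  · constructor <;> group
  · constructor <;> group
  · have hx' := mem_moore_two.1 hx
    rw [hx'.1, hx'.2]
    constructor <;> simp

theorem d₂_eq_one_of_mem_P₂ {w : T _⦋2⦌} (hw : w ∈ P₂ T) : d₂ T w = 1 := by
  have : P₂ T ≤ (d₂ T).ker := by
    apply P₂_le <;> intro x hx y hy <;> rw [MonoidHom.mem_ker] <;>
      simp only [comm, map_mul, map_inv, d₂_s₀, d₂_s₁, d₁_d₂]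
    · group
    · group
    · rw [(mem_moore_two.1 hy).2, map_one, map_one]; group
    · group
    · rw [(mem_moore_two.1 hx).2, map_one, map_one]; group
    · group
  exact this hw

theorem d₂_mem_P₁ {w : T _⦋2⦌} (hw : w ∈ Q₂ T ⊔ P₂ T) : d₂ T w ∈ P₁ T := by
  have : Q₂ T ⊔ P₂ T ≤ (P₁ T).comap (d₂ T) :=
    sup_le (fun _ h => d₂_mem_P₁_of_mem_Q₂ T h) fun x h => by
      rw [Subgroup.mem_comap, d₂_eq_one_of_mem_P₂ T h]
      exact one_mem _
  exact this hw

theorem Q₂P₂_le_moore : Q₂ T ⊔ P₂ T ≤ moore T 2 := sup_le inf_le_left (P₂_le_moore T)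

end Peiffer

/-! ### The action of `T_2` on `NT_2 / (Q_2 · P_2)` -/

section Action

variable (T : SimplicialObject GrpCat.{u})

/-- Divide by `s_0 d_0`, then by `s_1 d_1`. The second division does not disturb `d_0`, since `d_0
s_1 d_1 = s_0 d_0 d_1 = s_0 d_0 d_0`. -/
theorem exists_moore_mul_degenerate (t : T _⦋2⦌) :
    ∃ y ∈ moore T 2, ∃ w ∈ degenerate T 2, t = y * w := by
  refine ⟨t * (s₀ T (d₀₂ T t))⁻¹ * (s₁ T (d₁₂ T (t * (s₀ T (d₀₂ T t))⁻¹)))⁻¹, ?_,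
    s₁ T (d₁₂ T (t * (s₀ T (d₀₂ T t))⁻¹)) * s₀ T (d₀₂ T t),
    mul_mem (s₁_mem_degenerate _) (s₀_mem_degenerate _), by group⟩
  have h : d₀₂ T (t * (s₀ T (d₀₂ T t))⁻¹) = 1 := by
    rw [map_mul, map_inv, d₀₂_s₀, mul_inv_cancel]
  rw [mem_moore_two, map_mul _ (t * _), map_mul _ (t * _), h, map_inv, map_inv, d₀₂_s₁, d₁₂_s₁,
    d₀'_d₁₂, h, mul_inv_cancel]
  simp

/-- Conjugation by degenerate elements preserves both `NT_2` and `D_2`, hence `Q_2`; conjugation by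
`NT_2` is covered by `Q₂P₂_normal`. -/
theorem Q₂P₂_normal_top : (Q₂ T ⊔ P₂ T).Normal := by
  refine ⟨fun x hx t => ?_⟩
  obtain ⟨y, hy, w, hw, rfl⟩ := exists_moore_mul_degenerate T t
  have h : w * x * w⁻¹ ∈ Q₂ T ⊔ P₂ T := by
    rw [← SetLike.mem_coe, Subgroup.mul_normal] at hx
    obtain ⟨q, hq, p, hp, rfl⟩ := Set.mem_mul.mp hx
    have : w * (q * p) * w⁻¹ = (w * q * w⁻¹) * (w * p * w⁻¹) := by group
    rw [this]
    exact mul_mem (Subgroup.mem_sup_left ⟨(moore_normal T 2).conj_mem q hq.1 w,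
      mul_mem (mul_mem hw hq.2) ((degenerate T 2).inv_mem hw)⟩)
      (Subgroup.mem_sup_right (Subgroup.Normal.conj_mem inferInstance _ hp _))
  have h' := (Q₂P₂_normal T).conj_mem ⟨w * x * w⁻¹, Q₂P₂_le_moore T h⟩
    (Subgroup.mem_subgroupOf.2 h) ⟨y, hy⟩
  rw [Subgroup.mem_subgroupOf] at h'
  convert h' using 1
  push_cast
  group

attribute [local instance] Q₂P₂_normal_top

/-- The subgroup of `T_2` of elements acting trivially, by conjugation, on `NT_2 / (Q_2 · P_2)`. -/
def actionKernel : Subgroup (T _⦋2⦌) :=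
  (Subgroup.centralizer ((moore T 2).map (QuotientGroup.mk' (Q₂ T ⊔ P₂ T)) :
    Set (T _⦋2⦌ ⧸ (Q₂ T ⊔ P₂ T)))).comap (QuotientGroup.mk' (Q₂ T ⊔ P₂ T))

theorem actionKernel_normal : (actionKernel T).Normal := by
  have : ((moore T 2).map (QuotientGroup.mk' (Q₂ T ⊔ P₂ T))).Normal :=
    (moore_normal T 2).map _ (QuotientGroup.mk'_surjective _)
  unfold actionKernel
  infer_instance

attribute [local instance] actionKernel_normal

variable {T}

theorem mem_actionKernel {t : T _⦋2⦌} : t ∈ actionKernel T ↔ ∀ y ∈ moore T 2,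
    ((y : T _⦋2⦌ ⧸ (Q₂ T ⊔ P₂ T))) * t = t * y := by
  simp [actionKernel, Subgroup.mem_centralizer_iff]

theorem mk_mul_eq_of_comm_mem {G : Type u} [Group G] {L : Subgroup G} [L.Normal] {a b : G}
    (h : comm a b ∈ L) : (b : G ⧸ L) * a = a * b := by
  rw [← QuotientGroup.eq_one_iff] at h
  simp only [comm, QuotientGroup.mk_mul, QuotientGroup.mk_inv] at h
  rw [mul_inv_eq_one, mul_inv_eq_iff_eq_mul] at h
  exact h.symm

/-- Supplies the commutation relations that hold modulo `Q_2` without any help from `P_2`. -/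
theorem comm_mem_Q₂ {a b : T _⦋2⦌} (ha : a ∈ degenerate T 2) (hb : b ∈ degenerate T 2)
    (ha' : d₁₂ T a = 1) (hb' : d₀₂ T b = 1) : comm a b ∈ Q₂ T := by
  refine ⟨mem_moore_two.2 ?_, mul_mem (mul_mem (mul_mem ha hb)
    ((degenerate T 2).inv_mem ha)) ((degenerate T 2).inv_mem hb)⟩
  simp only [comm, map_mul, map_inv, ha', hb']
  constructor <;> group

/-- With `z = s_1(d_2 y)⁻¹ s_0(d_2 y)`, family 3 says that `y z` commutes with `s_1 x`, and `z` does
so modulo `Q_2`; hence so does `y`. -/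
theorem s₁_mem_actionKernel {x : T _⦋1⦌} (hx : x ∈ moore T 1) : s₁ T x ∈ actionKernel T := by
  rw [mem_actionKernel]
  intro y hy
  have h₁ : comm (y * (s₁ T (d₂ T y))⁻¹ * s₀ T (d₂ T y)) (s₁ T x) ∈ Q₂ T ⊔ P₂ T :=
    Subgroup.mem_sup_right (Subgroup.subset_normalClosure
      (Or.inl (Or.inl (Or.inl (Or.inr ⟨x, hx, y, hy, rfl⟩)))))
  have h₂ : comm ((s₁ T (d₂ T y))⁻¹ * s₀ T (d₂ T y)) (s₁ T x) ∈ Q₂ T ⊔ P₂ T := by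
    refine Subgroup.mem_sup_left (comm_mem_Q₂ (mul_mem (inv_mem (s₁_mem_degenerate _))
      (s₀_mem_degenerate _)) (s₁_mem_degenerate _) ?_ ?_)
    · rw [map_mul, map_inv, d₁₂_s₁, d₁₂_s₀, inv_mul_cancel]
    · rw [d₀₂_s₁, mem_moore_one.1 hx, map_one]
  rw [mul_assoc] at h₁
  have h₁ := mk_mul_eq_of_comm_mem h₁
  have h₂ := mk_mul_eq_of_comm_mem h₂
  rw [QuotientGroup.mk_mul, mul_assoc, ← h₂, ← mul_assoc, ← mul_assoc] at h₁
  exact (mul_right_cancel h₁).symm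

/-- Family 2 makes `s_1 x⁻¹ s_0 x` commute with `s_1(d_2 y) y⁻¹`, and modulo `Q_2` it commutes with
`s_1(d_2 y)`; hence it commutes with `y`. -/
theorem s₀_mem_actionKernel {x : T _⦋1⦌} (hx : x ∈ moore T 1) : s₀ T x ∈ actionKernel T := by
  suffices h : (s₁ T x)⁻¹ * s₀ T x ∈ actionKernel T by
    simpa using mul_mem (s₁_mem_actionKernel hx) h
  rw [mem_actionKernel]
  intro y hy
  have h₁ : comm ((s₁ T x)⁻¹ * s₀ T x) (s₁ T (d₂ T y) * y⁻¹) ∈ Q₂ T ⊔ P₂ T :=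
    Subgroup.mem_sup_right (Subgroup.subset_normalClosure
      (Or.inl (Or.inl (Or.inl (Or.inl (Or.inr ⟨x, hx, y, hy, rfl⟩))))))
  have h₂ : comm ((s₁ T x)⁻¹ * s₀ T x) (s₁ T (d₂ T y)) ∈ Q₂ T ⊔ P₂ T := by
    refine Subgroup.mem_sup_left (comm_mem_Q₂ (mul_mem (inv_mem (s₁_mem_degenerate _))
      (s₀_mem_degenerate _)) (s₁_mem_degenerate _) ?_ ?_)
    · rw [map_mul, map_inv, d₁₂_s₁, d₁₂_s₀, inv_mul_cancel]
    · rw [d₀₂_s₁, d₀'_d₂, (mem_moore_two.1 hy).1, map_one, map_one]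
  have h₁ := mk_mul_eq_of_comm_mem h₁
  have h₂ := mk_mul_eq_of_comm_mem h₂
  generalize (s₁ T x)⁻¹ * s₀ T x = z at h₁ h₂ ⊢
  rw [QuotientGroup.mk_mul, ← mul_assoc, ← h₂, mul_assoc, mul_assoc] at h₁
  have h₁ := mul_left_cancel h₁
  rw [QuotientGroup.mk_inv, inv_mul_eq_iff_eq_mul, ← mul_assoc, eq_mul_inv_iff_mul_eq] at h₁
  exact h₁.symm

theorem moore_le_actionKernel : moore T 2 ≤ actionKernel T := by
  intro y hy
  have h : y⁻¹ * s₁ T (d₂ T y) ∈ actionKernel T := mem_actionKernel.2 fun y' hy' =>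
    mk_mul_eq_of_comm_mem (Subgroup.mem_sup_right (Subgroup.subset_normalClosure
      (Or.inl (Or.inl (Or.inr ⟨y, hy, y', hy', rfl⟩)))))
  have := mul_mem (s₁_mem_actionKernel (d₂_mem_moore hy)) (inv_mem h)
  simpa using this

theorem s₁_s₀'_d₁_mem_actionKernel {x : T _⦋1⦌} (hx : x ∈ moore T 1) :
    s₁ T (s₀' T (d₁ T x)) ∈ actionKernel T := by
  have h : (s₀ T x)⁻¹ * s₁ T (s₀' T (d₁ T x)) ∈ actionKernel T := mem_actionKernel.2 fun y hy =>
    mk_mul_eq_of_comm_mem (Subgroup.mem_sup_right (Subgroup.subset_normalClosure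
      (Or.inl (Or.inl (Or.inl (Or.inl (Or.inl ⟨x, hx, y, hy, rfl⟩)))))))
  simpa using mul_mem (s₀_mem_actionKernel hx) h

/-- Every element of `T_2` acts on `NT_2 / (Q_2 · P_2)` as its initial vertex. -/
theorem mul_inv_vertex_mem_actionKernel (t : T _⦋2⦌) :
    t * (s₁ T (s₀' T (d₀' T (d₀₂ T t))))⁻¹ ∈ actionKernel T := by
  have hdec (x : T _⦋1⦌) : x * (s₀' T (d₀' T x))⁻¹ ∈ moore T 1 := by
    rw [mem_moore_one, map_mul, map_inv, d₀'_s₀', mul_inv_cancel]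
  let m := QuotientGroup.mk' (actionKernel T)
  let f : T _⦋2⦌ →* T _⦋2⦌ := (s₁ T).comp ((s₀' T).comp ((d₀' T).comp (d₀₂ T)))
  have hm {a b : T _⦋2⦌} : m a = m b ↔ a * b⁻¹ ∈ actionKernel T := by
    rw [← div_eq_mul_inv]
    exact QuotientGroup.eq_iff_div_mem
  -- On `s_0 x` and `s_1 x` the discrepancy is a degeneracy of `x s_0(d_0 x)⁻¹`, which lies in
  -- `NT_1`; here `s_1 s_0 = s_0 s_0` is used.
  have h : degenerate T 2 ≤ m.eqLocus (m.comp f) := by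
    refine degenerate_two_le (fun x => ?_) fun x => ?_
    · change m _ = m (s₁ T (s₀' T (d₀' T (d₀₂ T _))))
      rw [hm, d₀₂_s₀, s₁_s₀', ← map_inv, ← map_mul]
      exact s₀_mem_actionKernel (hdec x)
    · change m _ = m (s₁ T (s₀' T (d₀' T (d₀₂ T _))))
      rw [hm, d₀₂_s₁, d₀'_s₀', ← map_inv, ← map_mul]
      exact s₁_mem_actionKernel (hdec x)
  obtain ⟨y, hy, w, hw, rfl⟩ := exists_moore_mul_degenerate T t
  have hy' : m y = m (f y) := by
    change m _ = m (s₁ T (s₀' T (d₀' T (d₀₂ T _))))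
    rw [(mem_moore_two.1 hy).1, map_one, map_one, map_one, map_one]
    exact (QuotientGroup.eq_one_iff _).2 (moore_le_actionKernel hy)
  refine hm.1 ?_
  change m (y * w) = m (f (y * w))
  rw [map_mul, map_mul, map_mul, hy', show m w = m (f w) from h hw]

/-- When `d_1(NT_1) = ker g`, this makes the action of `T_2` factor through `G`. -/
theorem mem_actionKernel_of_vertex {t : T _⦋2⦌}
    (ht : d₀' T (d₀₂ T t) ∈ (moore T 1).map (d₁ T)) : t ∈ actionKernel T := by
  obtain ⟨x, hx, h⟩ := ht
  have := mul_mem (mul_inv_vertex_mem_actionKernel t) (s₁_s₀'_d₁_mem_actionKernel hx)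
  rwa [h, inv_mul_cancel_right] at this

/-- Elements of `NT_2` conjugate by an element acting trivially have the same class. -/
theorem mk_eq_mk_of_mem_actionKernel {t : T _⦋2⦌} (ht : t ∈ actionKernel T) {y y' : moore T 2}
    (h : (y' : T _⦋2⦌) = t * y * t⁻¹) : (y' : C₂ T) = (y : C₂ T) := by
  rw [QuotientGroup.eq_iff_div_mem, Subgroup.mem_subgroupOf]
  have h' := mem_actionKernel.1 ht y y.2
  rw [Subgroup.coe_div, ← QuotientGroup.eq_iff_div_mem, h, QuotientGroup.mk_mul,
    QuotientGroup.mk_mul, ← h', QuotientGroup.mk_inv, mul_inv_cancel_right]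

theorem C₂_mul_comm (a b : C₂ T) : a * b = b * a := by
  obtain ⟨y, rfl⟩ := QuotientGroup.mk_surjective a
  obtain ⟨y', rfl⟩ := QuotientGroup.mk_surjective b
  rw [← mul_inv_eq_iff_eq_mul]
  exact mk_eq_mk_of_mem_actionKernel (moore_le_actionKernel y.2) (y' := y * y' * y⁻¹) rfl

variable (T) in
/-- The abelian group `NT_2 / (Q_2 · P_2)`. -/
abbrev C₂.commGroup : CommGroup (C₂ T) := { (inferInstance : Group (C₂ T)) with mul_comm := C₂_mul_comm }

end Action

/-! ### Generators of `NT_1` and `NT_2` -/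

/-- The part in dimensions at most `2` of the data of a free simplicial resolution with
CW-basis. -/
structure IsLowDimResolution (T : SimplicialObject GrpCat.{u}) (B : ∀ n : ℕ, Set (T _⦋n⦌))
    {G : Type u} [Group G] (g : T _⦋0⦌ →* G) : Prop where
  free : ∀ n ≤ 2, Function.Bijective (FreeGroup.lift (fun b : B n => (b : T _⦋n⦌)))
  degen_mem : ∀ (n : ℕ) (i : Fin (n + 1)), ∀ x ∈ B n, degen T i x ∈ B (n + 1)
  nondeg_le : ∀ n, nondeg B (n + 1) ⊆ moore T (n + 1)
  surjective : Function.Surjective g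
  ker_eq : g.ker = (moore T 1).map (d₁ T)
  exact_one : moore T 1 ⊓ (d₁ T).ker = (moore T 2).map (d₂ T)

section

variable {T : SimplicialObject GrpCat.{u}} {B : ∀ n : ℕ, Set (T _⦋n⦌)}

theorem mem_nondeg_one_or {x : T _⦋1⦌} (hx : x ∈ B 1) :
    x ∈ nondeg B 1 ∨ ∃ a ∈ B 0, x = s₀' T a := by
  by_cases h : x ∈ ⋃ i : Fin 1, degen T i '' B 0
  · obtain ⟨i, a, ha, rfl⟩ := Set.mem_iUnion.1 h
    rw [Fin.fin_one_eq_zero i]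
    exact Or.inr ⟨a, ha, rfl⟩
  · exact Or.inl ⟨hx, h⟩

theorem mem_nondeg_two_or {x : T _⦋2⦌} (hx : x ∈ B 2) :
    x ∈ nondeg B 2 ∨ ∃ c ∈ B 1, x = s₀ T c ∨ x = s₁ T c := by
  by_cases h : x ∈ ⋃ i : Fin 2, degen T i '' B 1
  · obtain ⟨i, a, ha, rfl⟩ := Set.mem_iUnion.1 h
    refine Or.inr ⟨a, ha, ?_⟩
    fin_cases i
    exacts [Or.inl rfl, Or.inr rfl]
  · exact Or.inl ⟨hx, h⟩

theorem degen_notMem_nondeg_two (i : Fin 2) {c : T _⦋1⦌} (hc : c ∈ B 1) :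
    degen T i c ∉ nondeg B 2 :=
  fun h => h.2 (Set.mem_iUnion.2 ⟨i, c, hc, rfl⟩)

end

namespace IsLowDimResolution

variable {T : SimplicialObject GrpCat.{u}} {B : ∀ n : ℕ, Set (T _⦋n⦌)} {G : Type u} [Group G]
  {g : T _⦋0⦌ →* G}

theorem moore_one_eq (hT : IsLowDimResolution T B g) :
    moore T 1 = Subgroup.normalClosure (nondeg B 1) := by
  rw [← ker_eq_normalClosure (d₀' T) (s₀' T) (fun x hx => mem_moore_one.1 (hT.nondeg_le 0 hx))
    (closure_eq_top_of_bijective_lift (hT.free 1 (by decide))) fun b hb => ?_]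
  · ext x
    exact mem_moore_one
  · rcases mem_nondeg_one_or hb with h | ⟨a, -, rfl⟩
    · rw [mem_moore_one.1 (hT.nondeg_le 0 h), map_one, inv_one, mul_one]
      exact Subgroup.subset_normalClosure h
    · rw [d₀'_s₀', mul_inv_cancel]
      exact one_mem _

theorem moore_two_eq (hT : IsLowDimResolution T B g) :
    moore T 2 = Subgroup.normalClosure (s₁ T '' nondeg B 1 ∪ nondeg B 2) ⊓
      Subgroup.normalClosure
        ((fun y => (s₁ T y)⁻¹ * s₀ T y) '' nondeg B 1 ∪ nondeg B 2) := by
  have hY {x : T _⦋2⦌} (hx : x ∈ nondeg B 2) := mem_moore_two.1 (hT.nondeg_le 1 hx)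
  have hB := closure_eq_top_of_bijective_lift (hT.free 2 le_rfl)
  rw [← ker_eq_normalClosure (d₀₂ T) (s₀ T) ?_ hB fun b hb => ?_,
    ← ker_eq_normalClosure (d₁₂ T) (s₁ T) ?_ hB fun b hb => ?_]
  · ext x
    exact mem_moore_two
  · rintro _ (⟨y, hy, rfl⟩ | hx)
    · change d₁₂ T ((s₁ T y)⁻¹ * s₀ T y) = 1
      rw [map_mul, map_inv, d₁₂_s₁, d₁₂_s₀, inv_mul_cancel]
    · exact (hY hx).2
  · rcases mem_nondeg_two_or hb with h | ⟨c, hc, rfl | rfl⟩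
    · rw [(hY h).2, map_one, inv_one, mul_one]
      exact Subgroup.subset_normalClosure (Or.inr h)
    · rw [d₁₂_s₀]
      rcases mem_nondeg_one_or hc with h | ⟨a, -, rfl⟩
      -- `s_0 c (s_1 c)⁻¹` is the conjugate by `s_1 c` of the element `(s_1 c)⁻¹ s_0 c` of `Z`.
      · have := Subgroup.normalClosure_normal.conj_mem _ (Subgroup.subset_normalClosure
          (s := (fun y => (s₁ T y)⁻¹ * s₀ T y) '' nondeg B 1 ∪ nondeg B 2)
          (Or.inl ⟨c, h, rfl⟩)) (s₁ T c)
        simpa using this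
      · rw [s₁_s₀', mul_inv_cancel]
        exact one_mem _
    · rw [d₁₂_s₁, mul_inv_cancel]
      exact one_mem _
  · rintro _ (⟨y, hy, rfl⟩ | hx)
    · rw [d₀₂_s₁, mem_moore_one.1 (hT.nondeg_le 0 hy), map_one]
    · exact (hY hx).1
  · rcases mem_nondeg_two_or hb with h | ⟨c, hc, rfl | rfl⟩
    · rw [(hY h).1, map_one, inv_one, mul_one]
      exact Subgroup.subset_normalClosure (Or.inr h)
    · rw [d₀₂_s₀, mul_inv_cancel]
      exact one_mem _
    · rcases mem_nondeg_one_or hc with h | ⟨a, -, rfl⟩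
      · rw [d₀₂_s₁, mem_moore_one.1 (hT.nondeg_le 0 h), map_one, map_one, inv_one, mul_one]
        exact Subgroup.subset_normalClosure (Or.inl ⟨c, h, rfl⟩)
      · rw [s₁_s₀', d₀₂_s₀, mul_inv_cancel]
        exact one_mem _

theorem normalClosure_nondeg_le (hT : IsLowDimResolution T B g) :
    Subgroup.normalClosure (nondeg B 2) ≤ moore T 2 :=
  Subgroup.normalClosure_le_normal (hT.nondeg_le 1)

/-- `NT_2` is generated by the conjugates of `Y_2` together with `Q_2`. -/
theorem moore_two_le (hT : IsLowDimResolution T B g) {y : T _⦋2⦌} (hy : y ∈ moore T 2) :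
    ∃ k ∈ Subgroup.normalClosure (nondeg B 2), ∃ q ∈ Q₂ T, y = k * q := by
  -- `T_2 = ⟨Y_2⟩ D_2`. Since `⟨Y_2⟩ ≤ NT_2`, the degenerate factor of an element of `NT_2` again
  -- lies in `NT_2`.
  have htop : Subgroup.normalClosure (nondeg B 2) ⊔ degenerate T 2 = ⊤ := by
    rw [eq_top_iff, ← closure_eq_top_of_bijective_lift (hT.free 2 le_rfl), Subgroup.closure_le]
    intro b hb
    rcases mem_nondeg_two_or hb with h | ⟨c, hc, rfl | rfl⟩
    · exact Subgroup.mem_sup_left (Subgroup.subset_normalClosure h)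
    · exact Subgroup.mem_sup_right (s₀_mem_degenerate c)
    · exact Subgroup.mem_sup_right (s₁_mem_degenerate c)
  have hy' : y ∈ Subgroup.normalClosure (nondeg B 2) ⊔ degenerate T 2 := htop ▸ Subgroup.mem_top y
  rw [← SetLike.mem_coe, Subgroup.normal_mul] at hy'
  obtain ⟨k, hk, w, hw, rfl⟩ := Set.mem_mul.mp hy'
  refine ⟨k, hk, w, ⟨?_, hw⟩, rfl⟩
  simpa using mul_mem (inv_mem (hT.normalClosure_nondeg_le hk)) hy

end IsLowDimResolution

theorem _root_.SemidirectProduct.conj_inl {A H : Type*} [CommGroup A] [Group H]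
    {φ : H →* MulAut A} (x : A ⋊[φ] H) (a : A) :
    x * .inl a * x⁻¹ = .inl (φ x.right a) := by
  ext
  · simp [mul_right_comm]
  · simp

/-! ### Fox derivative and freeness of `NT_2 / (Q_2 · P_2)` -/

section Fox

variable (T : SimplicialObject GrpCat.{u}) (B : ∀ n : ℕ, Set (T _⦋n⦌)) (G : Type u) [Group G]

/-- The free `ℤ[G]`-module on `Y_2`. -/
abbrev FreeOnNondeg : Type u :=
  {y : moore T 2 // (y : T _⦋2⦌) ∈ nondeg B 2} →₀ MonoidAlgebra ℤ G

/-- The action of `G` on the free `ℤ[G]`-module on `Y_2`, written multiplicatively. -/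
noncomputable def freeOnNondegAut : G →* MulAut (Multiplicative (FreeOnNondeg T B G)) :=
  @MulDistribMulAction.toMulAut G (Multiplicative (FreeOnNondeg T B G)) _ _
    (pullbackAction (MonoidHom.id G) _)

variable {T B G}

variable {g : T _⦋0⦌ →* G}

namespace IsLowDimResolution

/-- The Fox derivative on `T_2`, as a homomorphism to a semidirect product. -/
theorem exists_fox (hT : IsLowDimResolution T B g) :
    ∃ F : T _⦋2⦌ →* Multiplicative (FreeOnNondeg T B G) ⋊[freeOnNondegAut T B G] G,
      (∀ y : {y : moore T 2 // (y : T _⦋2⦌) ∈ nondeg B 2},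
        F y.1 = .inl (.ofAdd (Finsupp.single y 1))) ∧
      (∀ w ∈ degenerate T 2, (F w).left = 1) ∧
      ∀ t, (F t).right = g (d₀' T (d₀₂ T t)) := by
  classical
  -- Elements of `Y_2` go to basis vectors, degenerate basis elements to the image of their vertex
  -- in `G`.
  obtain ⟨F, hF⟩ := exists_hom_of_bijective_lift (hT.free 2 le_rfl) fun b =>
    if h : (b : T _⦋2⦌) ∈ nondeg B 2 then
      (SemidirectProduct.inl (.ofAdd (Finsupp.single ⟨⟨b, hT.nondeg_le 1 h⟩, h⟩ 1)) :
        Multiplicative (FreeOnNondeg T B G) ⋊[freeOnNondegAut T B G] G)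
    else .inr (g (d₀' T (d₀₂ T b)))
  have hY (y : {y : moore T 2 // (y : T _⦋2⦌) ∈ nondeg B 2}) :
      F y.1 = .inl (.ofAdd (Finsupp.single y 1)) := by
    rw [hF ⟨y.1, y.2.1⟩, dif_pos y.2]
  -- Degeneracies carry the basis of `T_1` to degenerate basis elements of `T_2`, so all of `D_2`
  -- lands in the complement `G`.
  have hD (i : Fin 2) (x : T _⦋1⦌) :
      degen T i x ∈ (SemidirectProduct.inr : G →* Multiplicative (FreeOnNondeg T B G)
        ⋊[freeOnNondegAut T B G] G).range.comap F := by
    have hx : x ∈ Subgroup.closure (B 1) := by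
      rw [closure_eq_top_of_bijective_lift (hT.free 1 (by decide))]
      exact Subgroup.mem_top x
    induction hx using Subgroup.closure_induction with
    | mem x hx =>
      rw [Subgroup.mem_comap, hF ⟨_, hT.degen_mem 1 i x hx⟩,
        dif_neg (degen_notMem_nondeg_two i hx)]
      exact ⟨_, rfl⟩
    | one => rw [map_one]; exact one_mem _
    | mul x y _ _ hx hy => rw [map_mul]; exact mul_mem hx hy
    | inv x _ hx => rw [map_inv]; exact inv_mem hx
  refine ⟨F, hY, fun w hw => ?_, fun t => ?_⟩
  · obtain ⟨h, hh⟩ := degenerate_two_le (hD 0) (hD 1) hw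
    rw [← hh, SemidirectProduct.left_inr]
  · have : SemidirectProduct.rightHom.comp F = g.comp ((d₀' T).comp (d₀₂ T)) := by
      refine MonoidHom.eq_of_eqOn_dense (closure_eq_top_of_bijective_lift (hT.free 2 le_rfl))
        fun b hb => ?_
      change SemidirectProduct.rightHom (F b) = g (d₀' T (d₀₂ T b))
      by_cases h : b ∈ nondeg B 2
      · rw [hY ⟨⟨b, hT.nondeg_le 1 h⟩, h⟩, SemidirectProduct.rightHom_inl,
          (mem_moore_two.1 (hT.nondeg_le 1 h)).1, map_one, map_one]
      · rw [hF ⟨b, hb⟩, dif_neg h, SemidirectProduct.rightHom_inr]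
    exact DFunLike.congr_fun this t

/-- The homomorphism from `NT_2 / (Q_2 · P_2)` to the free `ℤ[G]`-module on `Y_2` induced by
the Fox derivative. -/
theorem exists_foxQuotient (hT : IsLowDimResolution T B g) :
    ∃ θ : C₂ T →* Multiplicative (FreeOnNondeg T B G),
      (∀ y : {y : moore T 2 // (y : T _⦋2⦌) ∈ nondeg B 2},
        θ (y.1 : C₂ T) = .ofAdd (Finsupp.single y 1)) ∧
      ∀ (t : T _⦋2⦌) (y y' : moore T 2), (y' : T _⦋2⦌) = t * y * t⁻¹ →
        θ (y' : C₂ T) =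
          .ofAdd (MonoidAlgebra.of ℤ G (g (d₀' T (d₀₂ T t))) • (θ (y : C₂ T)).toAdd) := by
  obtain ⟨F, hY, hD, hq⟩ := hT.exists_fox
  have hinl {t : T _⦋2⦌} (ht : g (d₀' T (d₀₂ T t)) = 1) : F t = .inl (F t).left := by
    ext
    · rfl
    · rw [hq, ht, SemidirectProduct.right_inl]
  have hmoore {y : T _⦋2⦌} (hy : y ∈ moore T 2) : F y = .inl (F y).left :=
    hinl (by rw [(mem_moore_two.1 hy).1, map_one, map_one])
  have hvert {x : T _⦋1⦌} (hx : x ∈ moore T 1) : g (d₁ T x) = 1 := by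
    rw [← MonoidHom.mem_ker, hT.ker_eq]
    exact ⟨x, hx, rfl⟩
  -- Elements whose vertex dies in `G` land in the abelian normal factor. Every generator of `P_2`
  -- is a commutator of two such elements.
  have hcomm {a b : T _⦋2⦌} (ha : g (d₀' T (d₀₂ T a)) = 1) (hb : g (d₀' T (d₀₂ T b)) = 1) :
      F (comm a b) = 1 := by
    rw [comm, map_mul, map_mul, map_mul, map_inv, map_inv, hinl ha, hinl hb, ← map_mul,
      mul_comm (F a).left, map_mul]
    group
  have hP : P₂ T ≤ F.ker := by
    apply P₂_le <;> intro x hx y hy <;> refine hcomm ?_ ?_ <;>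
      try simp only [map_mul, map_inv, d₀₂_s₀, d₀₂_s₁, d₀'_s₀', d₀'_d₂]
    · rw [mem_moore_one.1 hx, hvert hx]; simp
    · rw [(mem_moore_two.1 hy).1]; simp
    · rw [mem_moore_one.1 hx]; simp
    · rw [(mem_moore_two.1 hy).1]; simp
    · rw [(mem_moore_two.1 hy).1]; simp
    · rw [mem_moore_one.1 hx]; simp
    · rw [(mem_moore_two.1 hx).1]; simp
    · rw [(mem_moore_two.1 hy).1]; simp
    · rw [(mem_moore_two.1 hx).1]; simp
    · rw [(mem_moore_two.1 hy).1]; simp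
    · rw [(mem_moore_two.1 hx).1]; simp
    · rw [(mem_moore_two.1 hy).1]; simp
  let f : moore T 2 →* Multiplicative (FreeOnNondeg T B G) := MonoidHom.mk' (fun y => (F y).left)
    fun y y' => by
      apply SemidirectProduct.inl_injective (φ := freeOnNondegAut T B G)
      rw [map_mul, ← hmoore y.2, ← hmoore y'.2, ← hmoore (y * y').2, Subgroup.coe_mul, map_mul]
  have hQP : Q₂ T ⊔ P₂ T ≤ F.ker := by
    refine sup_le (fun q hq => ?_) hP
    rw [MonoidHom.mem_ker, hmoore hq.1, hD q hq.2, map_one]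
  refine ⟨QuotientGroup.lift _ f fun y hy => ?_, fun y => ?_, fun t y y' h => ?_⟩
  · change (F y).left = 1
    rw [hQP (Subgroup.mem_subgroupOf.1 hy), SemidirectProduct.one_left]
  · change (F y.1).left = _
    rw [hY, SemidirectProduct.left_inl]
  · change (F y').left = freeOnNondegAut T B G (g (d₀' T (d₀₂ T t))) (F y).left
    apply SemidirectProduct.inl_injective (φ := freeOnNondegAut T B G)
    rw [← hmoore y'.2, h, map_mul, map_mul, map_inv, hmoore y.2, SemidirectProduct.conj_inl, hq,
      SemidirectProduct.left_inl]

/-- The isomorphism of the free `ℤ[G]`-module on `Y_2` with `NT_2 / (Q_2 · P_2)`. -/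
theorem exists_equiv (hT : IsLowDimResolution T B g) :
    ∃ e : Multiplicative (FreeOnNondeg T B G) ≃* C₂ T,
      (∀ y : {y : moore T 2 // (y : T _⦋2⦌) ∈ nondeg B 2},
        e (.ofAdd (Finsupp.single y 1)) = (y.1 : C₂ T)) ∧
      ∀ (a : T _⦋0⦌) (y y' : moore T 2),
        (y' : T _⦋2⦌) = s₁ T (s₀' T a) * y * (s₁ T (s₀' T a))⁻¹ →
          e (.ofAdd (MonoidAlgebra.of ℤ G (g a) • (e.symm (y : C₂ T)).toAdd)) = (y' : C₂ T) := by
  obtain ⟨θ, hY, hθ⟩ := hT.exists_foxQuotient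
  let _ : CommGroup (C₂ T) := C₂.commGroup T
  let Y := {y : moore T 2 // (y : T _⦋2⦌) ∈ nondeg B 2}
  -- A chosen element of `T_2` with vertex over each `h`; the choice does not affect the classes of
  -- conjugates by `mem_actionKernel_of_vertex`.
  let σ : G → T _⦋2⦌ := fun h => s₁ T (s₀' T (Function.surjInv hT.surjective h))
  have hσ (h : G) : g (d₀' T (d₀₂ T (σ h))) = h := by
    rw [d₀₂_s₁, d₀'_s₀', d₀'_s₀']
    exact Function.surjInv_eq hT.surjective h
  let c (t : T _⦋2⦌) (y : moore T 2) : moore T 2 := ⟨t * y * t⁻¹, (moore_normal T 2).conj_mem _ y.2 t⟩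
  -- Additivity is enough for the candidate inverse: equivariance is read off from `θ`.
  let ψ : FreeOnNondeg T B G →+ Additive (C₂ T) := Finsupp.liftAddHom fun y : Y =>
    (Finsupp.liftAddHom fun h : G => zmultiplesHom _ (Additive.ofMul (c (σ h) y.1 : C₂ T))).comp
      MonoidAlgebra.coeffAddEquiv.toAddMonoidHom
  have hψ (y : Y) (h : G) :
      ψ (Finsupp.single y (MonoidAlgebra.of ℤ G h)) = Additive.ofMul (c (σ h) y.1 : C₂ T) := by
    simp [ψ, MonoidAlgebra.of_apply]
  have hθψ : (AddMonoidHom.comp (MonoidHom.toAdditiveLeft θ) ψ) = AddMonoidHom.id _ := by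
    refine Finsupp.addHom_ext' fun y => MonoidAlgebra.addHom_ext' fun h => AddMonoidHom.ext_int ?_
    change (θ (ψ (Finsupp.single y (MonoidAlgebra.of ℤ G h))).toMul).toAdd =
      Finsupp.single y (MonoidAlgebra.of ℤ G h)
    rw [hψ, toMul_ofMul, hθ (σ h) y.1 _ rfl, hY, hσ, toAdd_ofAdd, toAdd_ofAdd, Finsupp.smul_single,
      smul_eq_mul, mul_one]
  -- `ψ ∘ θ` replaces the conjugator `t` by the chosen element over the same element of `G`; the two
  -- differ by an element acting trivially.
  have hgen (t : T _⦋2⦌) (y : Y) : ψ (θ (c t y.1 : C₂ T)).toAdd = Additive.ofMul (c t y.1 : C₂ T) := by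
    rw [hθ t y.1 _ rfl, hY, toAdd_ofAdd, toAdd_ofAdd, Finsupp.smul_single, smul_eq_mul, mul_one, hψ]
    refine congrArg Additive.ofMul (mk_eq_mk_of_mem_actionKernel
      (t := σ (g (d₀' T (d₀₂ T t))) * t⁻¹) (mem_actionKernel_of_vertex ?_) ?_)
    · rw [← hT.ker_eq, MonoidHom.mem_ker, map_mul, map_mul, map_mul, hσ, map_inv, map_inv, map_inv,
        mul_inv_cancel]
    · change σ _ * y.1 * (σ _)⁻¹ = _ * (t * y.1 * t⁻¹) * _
      group
  have hK (k : T _⦋2⦌) (hk : k ∈ Subgroup.normalClosure (nondeg B 2)) :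
      ∀ h : k ∈ moore T 2, ψ (θ ((⟨k, h⟩ : moore T 2) : C₂ T)).toAdd =
        Additive.ofMul ((⟨k, h⟩ : moore T 2) : C₂ T) := by
    have hle := hT.normalClosure_nondeg_le
    rw [Subgroup.normalClosure] at hk hle
    induction hk using Subgroup.closure_induction with
    | mem x hx =>
      intro h
      obtain ⟨y, hy, hc⟩ := Group.mem_conjugatesOfSet_iff.1 hx
      obtain ⟨t, rfl⟩ := isConj_iff.1 hc
      exact hgen t ⟨⟨y, hT.nondeg_le 1 hy⟩, hy⟩
    | one =>
      intro h
      have : (((⟨1, h⟩ : moore T 2) : moore T 2) : C₂ T) = 1 := rfl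
      rw [this, map_one, toAdd_one, map_zero, ofMul_one]
    | mul x x' hx hx' ih ih' =>
      intro h
      have : ((⟨x * x', h⟩ : moore T 2) : C₂ T) =
        ((⟨x, hle hx⟩ : moore T 2) : C₂ T) * ((⟨x', hle hx'⟩ : moore T 2) : C₂ T) := rfl
      rw [this, map_mul, toAdd_mul, map_add, ih, ih', ofMul_mul]
    | inv x hx ih =>
      intro h
      have : ((⟨x⁻¹, h⟩ : moore T 2) : C₂ T) = ((⟨x, hle hx⟩ : moore T 2) : C₂ T)⁻¹ := rfl
      rw [this, map_inv, toAdd_inv, map_neg, ih, ofMul_inv]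
  have hψθ (x : C₂ T) : (ψ (θ x).toAdd).toMul = x := by
    obtain ⟨y, rfl⟩ := QuotientGroup.mk_surjective x
    obtain ⟨k, hk, q, hq, h⟩ := hT.moore_two_le y.2
    have : (y : C₂ T) = ((⟨k, hT.normalClosure_nondeg_le hk⟩ : moore T 2) : C₂ T) := by
      rw [eq_comm, QuotientGroup.eq, Subgroup.mem_subgroupOf]
      refine Subgroup.mem_sup_left ?_
      change k⁻¹ * (y : T _⦋2⦌) ∈ Q₂ T
      rwa [h, inv_mul_cancel_left]
    rw [this, hK k hk, toMul_ofMul]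
  let e : Multiplicative (FreeOnNondeg T B G) ≃* C₂ T := MulEquiv.symm
    { θ with
      invFun := fun x => (ψ x.toAdd).toMul
      left_inv := hψθ
      right_inv := fun x => DFunLike.congr_fun hθψ x.toAdd }
  have he (x : C₂ T) : e.symm x = θ x := rfl
  refine ⟨e, fun y => ?_, fun a y y' h => ?_⟩
  · rw [← MulEquiv.eq_symm_apply, he, hY]
  · rw [← MulEquiv.eq_symm_apply, he, he, hθ _ _ _ h, d₀₂_s₁, d₀'_s₀', d₀'_s₀']

end IsLowDimResolution
end Fox

/-! ### From the skeleton to low-dimensional data -/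

section Skeleton

variable {T F : SimplicialObject GrpCat.{u}} (ι : T ⟶ F)

theorem app_face {n : ℕ} (i : Fin (n + 2)) (x : T _⦋n + 1⦌) :
    (ι.app (.op ⦋n⦌)).hom (face T i x) = face F i ((ι.app (.op ⦋n + 1⦌)).hom x) :=
  congrArg (fun f => f.hom x) (SimplicialObject.δ_naturality ι i)

theorem app_degen {n : ℕ} (i : Fin (n + 1)) (x : T _⦋n⦌) :
    (ι.app (.op ⦋n + 1⦌)).hom (degen T i x) = degen F i ((ι.app (.op ⦋n⦌)).hom x) :=
  congrArg (fun f => f.hom x) (SimplicialObject.σ_naturality ι i)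

variable {ι}

theorem app_mem_moore_iff (hι : ∀ n : ℕ, Function.Injective (ι.app (.op ⦋n⦌)).hom) {n : ℕ}
    {x : T _⦋n + 1⦌} :
    (ι.app (.op ⦋n + 1⦌)).hom x ∈ moore F (n + 1) ↔ x ∈ moore T (n + 1) := by
  simp only [mem_moore_succ, ← app_face, map_eq_one_iff _ (hι n)]

theorem skeletonSubgroup_eq_top {k n : ℕ} (h : n ≤ k) : skeletonSubgroup F k n = ⊤ := by
  refine eq_top_iff.2 fun x _ => Subgroup.mem_iSup_of_mem n (Subgroup.mem_iSup_of_mem h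
    (Subgroup.mem_iSup_of_mem (𝟙 _) ⟨x, ?_⟩))
  simp

theorem face_degen_self {n : ℕ} (i : Fin (n + 1)) (x : F _⦋n⦌) :
    face F i.castSucc (degen F i x) = x :=
  congrArg (fun f => f.hom x) (F.δ_comp_σ_self (i := i))

theorem bijective_lift_preimage {A A' : Type*} [Group A] [Group A'] {f : A →* A'}
    (hf : Function.Bijective f) {D : Set A'}
    (hD : Function.Bijective (FreeGroup.lift (fun b : D => (b : A')))) :
    Function.Bijective (FreeGroup.lift (fun b : f ⁻¹' D => (b : A))) := by
  let e : f ⁻¹' D ≃ D := Equiv.ofBijective (fun b => ⟨f b, b.2⟩)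
    ⟨fun a b h => Subtype.ext (hf.1 (congrArg Subtype.val h)), fun b => by
      obtain ⟨a, ha⟩ := hf.2 b
      exact ⟨⟨a, by rw [Set.mem_preimage, ha]; exact b.2⟩, Subtype.ext ha⟩⟩
  have h : f.comp (FreeGroup.lift (fun b : f ⁻¹' D => (b : A))) =
      (FreeGroup.lift (fun b : D => (b : A'))).comp
        (FreeGroup.freeGroupCongr e).toMonoidHom := by
    ext b
    simp only [MonoidHom.comp_apply, FreeGroup.lift_apply_of]
    exact (FreeGroup.lift_apply_of (f := fun b : D => (b : A')) (x := e b)).symm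
  refine (Function.Bijective.of_comp_iff' hf _).1 ?_
  rw [← MonoidHom.coe_comp, h, MonoidHom.coe_comp]
  exact hD.comp (FreeGroup.freeGroupCongr e).bijective

/-- `ι` is bijective in degrees at most 2, and `π_1 = 1` involves only `NT_1` and `NT_2`. -/
theorem isLowDimResolution_of_skeleton {B : ∀ n : ℕ, Set (T _⦋n⦌)} {G : Type u} [Group G]
    {g : T _⦋0⦌ →* G} (hT : IsSkeletonOfFreeResolution 2 B g) : IsLowDimResolution T B g := by
  obtain ⟨F, BF, gF, ι, hBF, hF, hι, hrange, hB, rfl⟩ := hT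
  have hbij {n : ℕ} (hn : n ≤ 2) : Function.Bijective (ι.app (.op ⦋n⦌)).hom :=
    ⟨hι n, MonoidHom.range_eq_top.1 ((hrange n).trans (skeletonSubgroup_eq_top hn))⟩
  have hmoore {n : ℕ} (hn : n + 1 ≤ 2) (z : F _⦋n + 1⦌) (hz : z ∈ moore F (n + 1)) :
      ∃ x ∈ moore T (n + 1), (ι.app (.op ⦋n + 1⦌)).hom x = z := by
    obtain ⟨x, rfl⟩ := (hbij hn).2 z
    exact ⟨x, (app_mem_moore_iff hι).1 hz, rfl⟩
  refine ⟨fun n hn => ?_, fun n i x hx => ?_, fun n x hx => ?_,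
    hF.surjective.comp (hbij (by decide)).2, ?_, ?_⟩
  · rw [hB n]
    exact bijective_lift_preimage (hbij hn) (hBF.free n)
  · rw [hB, Set.mem_preimage] at hx ⊢
    rw [app_degen]
    exact hBF.degen_mem n i _ hx
  · rw [SetLike.mem_coe, ← app_mem_moore_iff hι, mem_moore_succ]
    have h1 := hx.1
    rw [hB, Set.mem_preimage] at h1
    refine hBF.face_nondeg n _ ⟨h1, fun h => hx.2 ?_⟩
    obtain ⟨i, z, hz, hzx⟩ := Set.mem_iUnion.1 h
    -- Non-degeneracy is preserved by `ι`: if `ι x = s_i z`, then `z = d_i(ι x) = ι(d_i x)`, so `x`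
    -- was already degenerate in `T`.
    have hz' : (ι.app (.op ⦋n⦌)).hom (face T i.castSucc x) = z := by
      rw [app_face, ← hzx, face_degen_self]
    refine Set.mem_iUnion.2 ⟨i, face T i.castSucc x, ?_, hι _ ?_⟩
    · rw [hB, Set.mem_preimage, hz']
      exact hz
    · rw [app_degen, hz', hzx]
  · ext a
    rw [MonoidHom.mem_ker, MonoidHom.comp_apply, ← MonoidHom.mem_ker, hF.ker_eq]
    constructor
    · rintro ⟨z, hz, hza⟩
      obtain ⟨x, hx, rfl⟩ := hmoore (by decide) z hz
      exact ⟨x, hx, hι 0 ((app_face ι 1 x).trans hza)⟩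
    · rintro ⟨x, hx, rfl⟩
      exact ⟨_, (app_mem_moore_iff hι).2 hx, (app_face ι 1 x).symm⟩
  · ext x
    have h := SetLike.ext_iff.1 (hF.acyclic 0) ((ι.app (.op ⦋1⦌)).hom x)
    rw [Subgroup.mem_inf, app_mem_moore_iff hι, MonoidHom.mem_ker] at h
    have hx : face F (Fin.last 1) ((ι.app (.op ⦋1⦌)).hom x) = 1 ↔ d₁ T x = 1 := by
      rw [← app_face, map_eq_one_iff _ (hι 0)]
      rfl
    rw [hx] at h
    refine h.trans ⟨?_, ?_⟩
    · rintro ⟨z, hz, hzx⟩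
      obtain ⟨y, hy, rfl⟩ := hmoore le_rfl z hz
      exact ⟨y, hy, hι 1 ((app_face ι 2 y).trans hzx)⟩
    · rintro ⟨y, hy, rfl⟩
      exact ⟨_, (app_mem_moore_iff hι).2 hy, (app_face ι 2 y).symm⟩

end Skeleton

/-! ### The free crossed module `NT_1 / P_1` and exactness -/

section CrossedModule

variable (T : SimplicialObject GrpCat.{u})

/-- The action of `T_0` on `NT_1 / P_1`, by conjugation through `s_0`. -/
@[reducible]
def C₁.action : MulDistribMulAction (T _⦋0⦌) (C₁ T) where
  smul a := QuotientGroup.map _ _ (MulAut.conjNormal (s₀' T a)).toMonoidHom fun x hx => by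
    rw [Subgroup.mem_subgroupOf] at hx
    exact Subgroup.Normal.conj_mem inferInstance _ hx _
  one_smul x := by
    obtain ⟨x, rfl⟩ := QuotientGroup.mk_surjective x
    refine congrArg QuotientGroup.mk (Subtype.ext ?_)
    change s₀' T 1 * x * (s₀' T 1)⁻¹ = x
    simp
  mul_smul a b x := by
    obtain ⟨x, rfl⟩ := QuotientGroup.mk_surjective x
    refine congrArg QuotientGroup.mk (Subtype.ext ?_)
    change s₀' T (a * b) * x * (s₀' T (a * b))⁻¹ =
      s₀' T a * (s₀' T b * x * (s₀' T b)⁻¹) * (s₀' T a)⁻¹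
    rw [map_mul]
    group
  smul_mul a := map_mul _
  smul_one a := map_one _

attribute [local instance] C₁.action

variable {T} in
theorem C₁.smul_mk (a : T _⦋0⦌) (x x' : moore T 1)
    (h : (x' : T _⦋1⦌) = s₀' T a * x * (s₀' T a)⁻¹) : a • (x : C₁ T) = (x' : C₁ T) :=
  congrArg QuotientGroup.mk (Subtype.ext h.symm)

/-- The boundary map `NT_1 / P_1 → T_0`. -/
def C₁.boundary : C₁ T →* T _⦋0⦌ :=
  QuotientGroup.lift _ ((d₁ T).comp (moore T 1).subtype) fun _ hx =>
    d₁_eq_one_of_mem_P₁ T (Subgroup.mem_subgroupOf.1 hx)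

theorem C₁.boundary_mk (x : moore T 1) : C₁.boundary T (x : C₁ T) = d₁ T x := rfl

theorem C₁.isCrossedModule : IsCrossedModule (C₁.boundary T) := by
  constructor
  · intro a x
    obtain ⟨x, rfl⟩ := QuotientGroup.mk_surjective x
    rw [C₁.smul_mk a x ⟨_, (moore_normal T 1).conj_mem _ x.2 (s₀' T a)⟩ rfl, C₁.boundary_mk,
      C₁.boundary_mk, map_mul, map_mul, map_inv, d₁_s₀']
  · intro x y
    obtain ⟨x, rfl⟩ := QuotientGroup.mk_surjective x
    obtain ⟨y, rfl⟩ := QuotientGroup.mk_surjective y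
    rw [C₁.boundary_mk,
      C₁.smul_mk _ y ⟨_, (moore_normal T 1).conj_mem _ y.2 (s₀' T (d₁ T x))⟩ rfl, eq_comm]
    refine QuotientGroup.eq_iff_div_mem.2 ?_
    rw [Subgroup.mem_subgroupOf, div_eq_mul_inv]
    exact peiffer_mem_P₁ T x.2 y.2

/-- The boundary map `NT_2 / (Q_2 · P_2) → NT_1 / P_1`. -/
def C₂.boundary : C₂ T →* C₁ T :=
  QuotientGroup.map _ _ (mooreD T 1) fun _ hy => Subgroup.mem_comap.2
    (Subgroup.mem_subgroupOf.2 (d₂_mem_P₁ T (Subgroup.mem_subgroupOf.1 hy)))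

theorem C₂.boundary_mk (y : moore T 2) : C₂.boundary T (y : C₂ T) = (mooreD T 1 y : C₁ T) := rfl

variable {T} {B : ∀ n : ℕ, Set (T _⦋n⦌)} {G : Type u} [Group G] {g : T _⦋0⦌ →* G}

namespace IsLowDimResolution

/-- Uniqueness part of the universal property of `NT_1 / P_1`. -/
theorem C₁_hom_ext (hT : IsLowDimResolution T B g) {M : Type u} [Group M]
    [MulDistribMulAction (T _⦋0⦌) M] {φ φ' : C₁ T →* M}
    (hφ : ∀ (a : T _⦋0⦌) x, φ (a • x) = a • φ x) (hφ' : ∀ (a : T _⦋0⦌) x, φ' (a • x) = a • φ' x)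
    (h : ∀ x : moore T 1, (x : T _⦋1⦌) ∈ nondeg B 1 → φ (x : C₁ T) = φ' (x : C₁ T)) : φ = φ' := by
  have hle := hT.moore_one_eq.ge
  have key (k : T _⦋1⦌) (hk : k ∈ Subgroup.normalClosure (nondeg B 1)) :
      ∀ h : k ∈ moore T 1, φ ((⟨k, h⟩ : moore T 1) : C₁ T) = φ' ((⟨k, h⟩ : moore T 1) : C₁ T) := by
    rw [Subgroup.normalClosure] at hk hle
    induction hk using Subgroup.closure_induction with
    | mem x hx =>
      intro hx'
      obtain ⟨y, hy, hc⟩ := Group.mem_conjugatesOfSet_iff.1 hx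
      obtain ⟨t, rfl⟩ := isConj_iff.1 hc
      have hym := hT.nondeg_le 0 hy
      have hu : t * (s₀' T (d₀' T t))⁻¹ ∈ moore T 1 := by
        rw [mem_moore_one, map_mul, map_inv, d₀'_s₀', mul_inv_cancel]
      -- Write `t = u s_0(d_0 t)` with `u ∈ NT_1`. Conjugation by `t` is the action of `d_0 t`
      -- followed by conjugation by `u`, which by the crossed module identity is again an action, so
      -- an equivariant map is determined on `Y_1`.
      have : ((⟨t * y * t⁻¹, hx'⟩ : moore T 1) : C₁ T) =
          ((⟨_, hu⟩ : moore T 1) : C₁ T) * d₀' T t • ((⟨y, hym⟩ : moore T 1) : C₁ T) *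
            ((⟨_, hu⟩ : moore T 1) : C₁ T)⁻¹ := by
        refine congrArg QuotientGroup.mk (Subtype.ext ?_)
        change t * y * t⁻¹ = (t * (s₀' T (d₀' T t))⁻¹) *
          (s₀' T (d₀' T t) * y * (s₀' T (d₀' T t))⁻¹) * (t * (s₀' T (d₀' T t))⁻¹)⁻¹
        group
      rw [← (C₁.isCrossedModule T).2] at this
      rw [this, hφ, hφ, hφ', hφ', h ⟨y, hym⟩ hy]
    | one => exact fun h => (map_one φ).trans (map_one φ').symm
    | mul x x' hx hx' ih ih' =>
      intro h
      have : ((⟨x * x', h⟩ : moore T 1) : C₁ T) =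
        ((⟨x, hle hx⟩ : moore T 1) : C₁ T) * ((⟨x', hle hx'⟩ : moore T 1) : C₁ T) := rfl
      rw [this, map_mul, map_mul, ih, ih']
    | inv x hx ih =>
      intro h
      have : ((⟨x⁻¹, h⟩ : moore T 1) : C₁ T) = ((⟨x, hle hx⟩ : moore T 1) : C₁ T)⁻¹ := rfl
      rw [this, map_inv, map_inv, ih]
  ext x
  exact key x (hT.moore_one_eq.le x.2) x.2

/-- The comparison homomorphism from `NT_1` to a crossed module. -/
theorem exists_moore_one_hom (hT : IsLowDimResolution T B g) {M : Type u} [Group M]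
    [MulDistribMulAction (T _⦋0⦌) M] (μ : M →* T _⦋0⦌) (hμ : IsCrossedModule μ)
    (w : {x : moore T 1 // (x : T _⦋1⦌) ∈ nondeg B 1} → M) (hw : ∀ s, μ (w s) = d₁ T s.1) :
    ∃ φ : C₁ T →* M, (∀ x, μ (φ x) = C₁.boundary T x) ∧
      (∀ (a : T _⦋0⦌) x, φ (a • x) = a • φ x) ∧ ∀ s, φ (s.1 : C₁ T) = w s := by
  classical
  let α : T _⦋0⦌ →* MulAut M := MulDistribMulAction.toMulAut (T _⦋0⦌) M
  obtain ⟨F, hF⟩ := exists_hom_of_bijective_lift (hT.free 1 (by decide)) fun b =>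
    if h : (b : T _⦋1⦌) ∈ nondeg B 1 then
      (SemidirectProduct.inl (w ⟨⟨b, hT.nondeg_le 0 h⟩, h⟩) : M ⋊[α] (T _⦋0⦌))
    else .inr (d₀' T b)
  have hB₁ := closure_eq_top_of_bijective_lift (hT.free 1 (by decide))
  have hB₀ := closure_eq_top_of_bijective_lift (hT.free 0 (by decide))
  have hY (s : {x : moore T 1 // (x : T _⦋1⦌) ∈ nondeg B 1}) : F s.1 = .inl (w s) := by
    rw [hF ⟨s.1, s.2.1⟩, dif_pos s.2]
  have hs (a : T _⦋0⦌) : F (s₀' T a) = .inr a := by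
    have : F.comp (s₀' T) = SemidirectProduct.inr := by
      refine MonoidHom.eq_of_eqOn_dense hB₀ fun a ha => ?_
      have h : s₀' T a ∉ nondeg B 1 := fun h => h.2 (Set.mem_iUnion.2 ⟨0, a, ha, rfl⟩)
      rw [MonoidHom.comp_apply, hF ⟨_, hT.degen_mem 0 0 a ha⟩, dif_neg h, d₀'_s₀']
    exact DFunLike.congr_fun this a
  have hright (x : T _⦋1⦌) : (F x).right = d₀' T x := by
    have : SemidirectProduct.rightHom.comp F = d₀' T := by
      refine MonoidHom.eq_of_eqOn_dense hB₁ fun b hb => ?_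
      rw [MonoidHom.comp_apply]
      rcases mem_nondeg_one_or hb with h | ⟨a, -, rfl⟩
      · rw [hY ⟨⟨b, hT.nondeg_le 0 h⟩, h⟩, SemidirectProduct.rightHom_inl,
          mem_moore_one.1 (hT.nondeg_le 0 h)]
      · rw [hs, SemidirectProduct.rightHom_inr, d₀'_s₀']
    exact DFunLike.congr_fun this x
  -- `d_1` corresponds to the homomorphism `(m, a) ↦ μ(m) a` on `M ⋊ T_0`.
  have hμF (x : T _⦋1⦌) : μ (F x).left * (F x).right = d₁ T x := by
    let l : M ⋊[α] (T _⦋0⦌) →* T _⦋0⦌ := SemidirectProduct.lift μ (MonoidHom.id _) fun a => by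
      ext m
      exact hμ.1 a m
    have : l.comp F = d₁ T := by
      refine MonoidHom.eq_of_eqOn_dense hB₁ fun b hb => ?_
      rw [MonoidHom.comp_apply]
      rcases mem_nondeg_one_or hb with h | ⟨a, -, rfl⟩
      · rw [hY ⟨⟨b, hT.nondeg_le 0 h⟩, h⟩, SemidirectProduct.lift_inl, hw]
      · rw [hs, SemidirectProduct.lift_inr, d₁_s₀', MonoidHom.id_apply]
    exact DFunLike.congr_fun this x
  have hinl {x : T _⦋1⦌} (hx : x ∈ moore T 1) : F x = .inl (F x).left := by
    ext
    · rfl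
    · rw [hright, mem_moore_one.1 hx, SemidirectProduct.right_inl]
  have hμF' {x : T _⦋1⦌} (hx : x ∈ moore T 1) : μ (F x).left = d₁ T x := by
    rw [← hμF, hright, mem_moore_one.1 hx, mul_one]
  have hconj (a : T _⦋0⦌) {x : T _⦋1⦌} (hx : x ∈ moore T 1) :
      F (s₀' T a * x * (s₀' T a)⁻¹) = .inl (a • (F x).left) := by
    rw [map_mul, map_mul, map_inv, hs, hinl hx, ← map_inv SemidirectProduct.inr,
      SemidirectProduct.left_inl]
    exact (SemidirectProduct.inl_aut (φ := α) a _).symm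
  -- For `x ∈ NT_1` the component of `F x` in `M` lies over `d_1 x`, so Peiffer elements die by the
  -- Peiffer identity in `M`.
  have hP : P₁ T ≤ F.ker := by
    refine Subgroup.normalClosure_le_normal ?_
    rintro _ ⟨x, hx, y, hy, rfl⟩
    rw [SetLike.mem_coe, MonoidHom.mem_ker, map_mul, map_inv, hconj _ hy, ← hμF' hx, hμ.2, map_mul,
      map_mul, map_inv, hinl hx, hinl hy, SemidirectProduct.left_inl, SemidirectProduct.left_inl,
      map_mul, map_mul, map_inv, mul_inv_cancel]
  let f : moore T 1 →* M := MonoidHom.mk' (fun x => (F x).left) fun x y => by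
    apply SemidirectProduct.inl_injective (φ := α)
    rw [map_mul, ← hinl x.2, ← hinl y.2, ← hinl (x * y).2, Subgroup.coe_mul, map_mul]
  refine ⟨QuotientGroup.lift _ f fun x hx => ?_, fun x => ?_, fun a x => ?_, fun s => ?_⟩
  · change (F x).left = 1
    rw [hP (Subgroup.mem_subgroupOf.1 hx), SemidirectProduct.one_left]
  · obtain ⟨x, rfl⟩ := QuotientGroup.mk_surjective x
    exact hμF' x.2
  · obtain ⟨x, rfl⟩ := QuotientGroup.mk_surjective x
    change (F (s₀' T a * x * (s₀' T a)⁻¹)).left = a • (F x).left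
    rw [hconj a x.2, SemidirectProduct.left_inl]
  · change (F s.1).left = w s
    rw [hY, SemidirectProduct.left_inl]

theorem isFreeCrossedModuleOn (hT : IsLowDimResolution T B g) :
    IsFreeCrossedModuleOn (C₁.boundary T)
      (fun x : {x : moore T 1 // (x : T _⦋1⦌) ∈ nondeg B 1} => (x.1 : C₁ T)) := by
  refine ⟨C₁.isCrossedModule T, fun M _ _ μ hμ w hw => ?_⟩
  obtain ⟨φ, h₁, h₂, h₃⟩ := hT.exists_moore_one_hom μ hμ w hw
  exact ⟨φ, ⟨h₁, h₂, h₃⟩, fun φ' h => hT.C₁_hom_ext h.2.1 h₂ fun x hx =>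
    (h.2.2 ⟨x, hx⟩).trans (h₃ ⟨x, hx⟩).symm⟩

theorem ker_eq_range_boundary (hT : IsLowDimResolution T B g) :
    g.ker = (C₁.boundary T).range := by
  rw [hT.ker_eq]
  ext a
  constructor
  · rintro ⟨x, hx, rfl⟩
    exact ⟨((⟨x, hx⟩ : moore T 1) : C₁ T), rfl⟩
  · rintro ⟨x, rfl⟩
    obtain ⟨x, rfl⟩ := QuotientGroup.mk_surjective x
    exact ⟨x, x.2, rfl⟩

/-- As `d_1` kills `P_1`, a class in `ker ∂_1` is represented by a genuine cycle, which `π_1 = 1`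
makes a boundary. -/
theorem ker_boundary_eq (hT : IsLowDimResolution T B g) :
    (C₁.boundary T).ker = (C₂.boundary T).range := by
  ext x
  obtain ⟨x, rfl⟩ := QuotientGroup.mk_surjective x
  have h := SetLike.ext_iff.1 hT.exact_one (x : T _⦋1⦌)
  rw [Subgroup.mem_inf, MonoidHom.mem_ker] at h
  constructor
  · intro hx
    obtain ⟨y, hy, hyx⟩ := h.1 ⟨x.2, hx⟩
    exact ⟨((⟨y, hy⟩ : moore T 2) : C₂ T), congrArg QuotientGroup.mk (Subtype.ext hyx)⟩
  · rintro ⟨y, hy⟩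
    obtain ⟨y, rfl⟩ := QuotientGroup.mk_surjective y
    rw [← hy, MonoidHom.mem_ker, C₂.boundary_mk, C₁.boundary_mk]
    change d₁ T (d₂ T y) = 1
    rw [d₁_d₂, (mem_moore_two.1 y.2).2, map_one]

end IsLowDimResolution

end CrossedModule

/-! ### Assembling the resolution -/

/-- A subgroup of a `ℤ[G]`-module stable under `G` is a submodule. -/
def submoduleOfStable {G A : Type u} [Group G] [AddCommGroup A] [Module (MonoidAlgebra ℤ G) A]
    (K : AddSubgroup A) (hK : ∀ (h : G), ∀ x ∈ K, MonoidAlgebra.of ℤ G h • x ∈ K) :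
    Submodule (MonoidAlgebra ℤ G) A :=
  { K with
    smul_mem' := fun r x hx => by
      induction r using MonoidAlgebra.induction_on with
      | of h => exact hK h x hx
      | add r s hr hs => rw [add_smul]; exact K.add_mem hr hs
      | smul n r hr => rw [smul_assoc]; exact K.zsmul_mem hr n }

end CrossedRes

theorem mainTheorem7 (T : SimplicialObject GrpCat.{u}) (B : ∀ n : ℕ, Set (T _⦋n⦌))
    (N : Subgroup (T _⦋0⦌)) [N.Normal]
    (hT : IsSkeletonOfFreeResolution 2 B (QuotientGroup.mk' N)) :
    -- the descriptions of `NT_1` and `NT_2`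
    moore T 1 = Subgroup.normalClosure (nondeg B 1) ∧
    moore T 2 =
      Subgroup.normalClosure (s₁ T '' nondeg B 1 ∪ nondeg B 2) ⊓
      Subgroup.normalClosure
        ((fun y => (s₁ T y)⁻¹ * s₀ T y) '' nondeg B 1 ∪ nondeg B 2) ∧
    -- a free crossed resolution of `T_0 / N` whose 2-skeleton is `C₂ T → C₁ T → T_0`
    ∃ (K : CrossedComplex.{u}) (e₀ : K.C 0 ≃* T _⦋0⦌) (e₁ : K.C 1 ≃* C₁ T) (e₂ : K.C 2 ≃* C₂ T),
      IsFreeCrossedResolution K ((QuotientGroup.mk' N).comp e₀.toMonoidHom) ∧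
      -- the boundary maps are induced by `d_1` and `d_2`
      (∀ x : moore T 1, e₀ (K.d 0 (e₁.symm (x : C₁ T))) = d₁ T x) ∧
      (∀ y : moore T 2, e₁ (K.d 1 (e₂.symm (y : C₂ T))) = (mooreD T 1 y : C₁ T)) ∧
      -- `T_0` acts by conjugation through `s_0` and `s_1 s_0`
      (∀ (a : T _⦋0⦌) (x x' : moore T 1),
        (x' : T _⦋1⦌) = s₀' T a * x * (s₀' T a)⁻¹ →
          e₁ (e₀.symm a • e₁.symm (x : C₁ T)) = (x' : C₁ T)) ∧
      (∀ (a : T _⦋0⦌) (y y' : moore T 2),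
        (y' : T _⦋2⦌) = s₁ T (s₀' T a) * y * (s₁ T (s₀' T a))⁻¹ →
          e₂ (e₀.symm a • e₂.symm (y : C₂ T)) = (y' : C₂ T)) ∧
      -- the free bases are given by `Y_1` and `Y_2`
      IsFreeCrossedModuleOn (K.d 0)
        (fun x : {x : moore T 1 // (x : T _⦋1⦌) ∈ nondeg B 1} => e₁.symm (x.1 : C₁ T)) ∧
      IsFreeModuleOn ((QuotientGroup.mk' N).comp e₀.toMonoidHom)
        (fun y : {y : moore T 2 // (y : T _⦋2⦌) ∈ nondeg B 2} => e₂.symm (y.1 : C₂ T)) := by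
  have h := isLowDimResolution_of_skeleton hT
  refine ⟨h.moore_one_eq, h.moore_two_eq, ?_⟩
  obtain ⟨e, heY, he⟩ := h.exists_equiv
  let g := QuotientGroup.mk' N
  let _ := C₁.action T
  let Y := {y : moore T 2 // (y : T _⦋2⦌) ∈ nondeg B 2}
  let del : Multiplicative (FreeOnNondeg T B (T _⦋0⦌ ⧸ N)) →* C₁ T :=
    (C₂.boundary T).comp e.toMonoidHom
  have hconj (a : T _⦋0⦌) (y : moore T 2) :
      e (.ofAdd (MonoidAlgebra.of ℤ _ (g a) • (e.symm (y : C₂ T)).toAdd)) =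
        ((⟨_, (moore_normal T 2).conj_mem _ y.2 (s₁ T (s₀' T a))⟩ : moore T 2) : C₂ T) :=
    he a y _ rfl
  have hdel (a : T _⦋0⦌) (x) :
      del (.ofAdd (MonoidAlgebra.of ℤ _ (g a) • x)) = a • del (.ofAdd x) := by
    obtain ⟨c, hc⟩ := e.symm.surjective (.ofAdd x)
    obtain ⟨y, rfl⟩ := QuotientGroup.mk_surjective c
    have hx : x = (e.symm (y : C₂ T)).toAdd := by rw [hc, toAdd_ofAdd]
    subst hx
    change C₂.boundary T (e _) = a • C₂.boundary T (e (e.symm (y : C₂ T)))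
    rw [hconj, MulEquiv.apply_symm_apply, C₂.boundary_mk, C₂.boundary_mk, eq_comm]
    refine C₁.smul_mk a _ _ ?_
    change d₂ T (s₁ T (s₀' T a) * y * (s₁ T (s₀' T a))⁻¹) = s₀' T a * d₂ T y * (s₀' T a)⁻¹
    rw [map_mul, map_mul, map_inv, d₂_s₁]
  -- The first module to be resolved is `ker ∂_2`, carried to the free module on `Y_2`; it is
  -- `G`-stable because `g` is surjective and `del` equivariant.
  let X : FreeStage (MonoidAlgebra ℤ (T _⦋0⦌ ⧸ N)) :=
    { S := Y
      K := submoduleOfStable (MonoidHom.toAdditiveRight del).ker fun p x hx => by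
        obtain ⟨a, rfl⟩ := h.surjective p
        have hx' : del (.ofAdd x) = 1 := hx
        change del (.ofAdd _) = 1
        rw [hdel, hx', smul_one] }
  have hker := h.ker_boundary_eq
  have hker' : (C₁.boundary T).ker = del.range := by
    rw [hker]
    ext x
    exact ⟨fun ⟨c, hc⟩ => ⟨e.symm c, by rw [← hc]; exact congrArg _ (e.apply_symm_apply c)⟩,
      fun ⟨c, hc⟩ => ⟨e c, hc⟩⟩
  have hcm := C₁.isCrossedModule T
  have hg (x : C₁ T) : g (C₁.boundary T x) = 1 := h.ker_eq_range_boundary.ge ⟨x, rfl⟩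
  have hμdel (x) : C₁.boundary T (del x) = 1 := hker'.ge ⟨x, rfl⟩
  have : IsFreeGroup (T _⦋0⦌) :=
    IsFreeGroup.ofMulEquiv (MulEquiv.ofBijective _ (h.free 0 (by decide)))
  -- In degree 2 the complex has the free module on `Y_2` itself, so `e` is the comparison with `C₂
  -- T`; in degrees 0 and 1 the comparison is the identity.
  refine ⟨extension g X (C₁.boundary T) hcm hg del (fun _ => Iff.rfl) hdel hμdel,
    MulEquiv.refl (T _⦋0⦌), MulEquiv.refl (C₁ T), e,
    extension_isFreeCrossedResolution g X (C₁.boundary T) hcm hg del (fun _ => Iff.rfl) hdel hμdel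
      h.surjective h.ker_eq_range_boundary hker' _ h.isFreeCrossedModuleOn,
    fun _ => rfl, fun y => ?_, C₁.smul_mk, he, h.isFreeCrossedModuleOn, ?_⟩
  · change C₂.boundary T (e (e.symm (y : C₂ T))) = _
    rw [e.apply_symm_apply, C₂.boundary_mk]
  · let _ := pullbackAction g (Y →₀ MonoidAlgebra ℤ (T _⦋0⦌ ⧸ N))
    have hfree := isFreeModuleOn_of_equiv g
      (Finsupp.basisSingleOne (R := MonoidAlgebra ℤ (T _⦋0⦌ ⧸ N)) (ι := Y))
      (MulEquiv.refl _) fun _ _ => rfl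
    have hb : (fun y : Y => e.symm (y.1 : C₂ T)) =
        fun y : Y => MulEquiv.refl _ (Multiplicative.ofAdd
          (Finsupp.basisSingleOne (R := MonoidAlgebra ℤ (T _⦋0⦌ ⧸ N)) y)) := by
      funext y
      rw [MulEquiv.symm_apply_eq, Finsupp.coe_basisSingleOne]
      exact (heY y).symm
    rw [← hb] at hfree
    exact hfree
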